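/- Let $X$ be either a Cantor space (a space homeomorphic to $\{0,1\}^{\mathbb N}$) or a locally compact, non-compact Cantor space (a space homeomorphic to an open, non-closed subset of a Cantor space). Let $\mathcal G$ be an étale groupoid with unit space $X$, i.e. a topological groupoid (not necessarily Hausdorff) whose source and range maps $s,r\colon\mathcal G\to X$ are local homeomorphisms. A *bisection* is an open set $T\subset\mathcal G$ such that $s|_T$ and $r|_T$ are homeomorphisms onto their images. Assume that $\mathcal G$ is *minimal* (every orbit $r(s^{-1}(x))$, $x\in X$, is dense in $X$) and *effective* (every bisection $T$ is determined by the homeomorphism $r\circ (s|_T)^{-1}\colon s(T)\to r(T)$). Let $\mathsf F(\mathcal G)$ be the full group: the group of bisections $g$ with $s(g)=r(g)=X$, under the product $gh=\{\gamma\delta:\gamma\in g,\ \delta\in h,\ s(\gamma)=r(\delta)\}$, acting on $X$ through the associated homeomorphisms. A *multisection* of degree $d$ is a family of bisections $F(i,j)$, $1\le i,j\le d$, such that the $F(i,i)$ are pairwise disjoint compact open subsets of $X$ and $F(i,j)F(j,k)=F(i,k)$ for all $i,j,k$; for a permutation $\sigma$ of $\{1,\dots,d\}$ put $F(\sigma)=\bigcup_i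 F(\sigma(i),i)\cup (X\setminus\bigcup_i F(i,i))\in\mathsf F(\mathcal G)$. Let $\mathsf A(\mathcal G)\le \mathsf F(\mathcal G)$ be the alternating full group, generated by all $F(\sigma)$ with $F$ a multisection of degree $d\ge 3$ and $\sigma$ an even permutation. For finite $Q\subset X$, let $\mathrm{St}_{\mathsf F(\mathcal G)}(Q)$ be the setwise stabiliser of $Q$ in $\mathsf F(\mathcal G)$, and let $\mathrm{St}^0_{\mathsf A(\mathcal G)}(Q)$ be the group of elements of $\mathsf A(\mathcal G)$ that fix pointwise a neighbourhood of $Q$. For subgroups $A,H$ of a group $G$, say that $H$ is *confined by* $A$ if the closure of $\{aHa^{-1}: a\in A\}$ in the space of subgroups of $G$ (with the Chabauty topology, induced from the product topology on $\{0,1\}^G$) does not contain $\{1\}$, and that $H$ is *confined* if it is confined by $G$. A *confining set* for $H$ relative to $A$ is a finite set $P\subset G\setminus\{1\}$ with $P\cap aHa^{-1}\neq\varnothing$ for all $a\in A$. **Theorem (Classification of confined subgroups).** For a subgroup $H\le \mathsf F(\mathcal G)$ the following are equivalent: 1. $H$ is confined; 2. $H$ is confined by $\mathsf A(\mathcal G)$;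 3. there is a unique finite (possibly empty) set $Q\subset X$ such that $\mathrm{St}^0_{\mathsf A(\mathcal G)}(Q)\le H\le \mathrm{St}_{\mathsf F(\mathcal G)}(Q)$. Moreover, if $P\subset\mathsf F(\mathcal G)\setminus\{1\}$ is a confining set for $H$ relative to $\mathsf F(\mathcal G)$ or to $\mathsf A(\mathcal G)$, then the set $Q$ in (3) satisfies $|Q|\le |P|-1$. -/

import Mathlib

open Set Topology
open scoped Pointwise

/-- An étale groupoid with unit space `X` and space of arrows `Γ`.  Both the composition
`comp γ δ _` (`γ` after `δ`) and its continuity refer to composable pairs only.  The space `Γ` is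
not assumed to be Hausdorff.  A local homeomorphism is in particular continuous and open. -/
structure EtaleGroupoid (X Γ : Type*) [TopologicalSpace X] [TopologicalSpace Γ] where
  source : Γ → X
  range : Γ → X
  unit : X → Γ
  comp : (γ δ : Γ) → source γ = range δ → Γ
  inv : Γ → Γ
  source_unit : ∀ x, source (unit x) = x
  range_unit : ∀ x, range (unit x) = x
  source_comp : ∀ γ δ h, source (comp γ δ h) = source δ
  range_comp : ∀ γ δ h, range (comp γ δ h) = range γ
  comp_assoc : ∀ (γ δ ε : Γ) (h₁ : source γ = range δ) (h₂ : source δ = range ε),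
    comp (comp γ δ h₁) ε ((source_comp γ δ h₁).trans h₂) =
      comp γ (comp δ ε h₂) (h₁.trans (range_comp δ ε h₂).symm)
  comp_unit : ∀ γ, comp γ (unit (source γ)) (range_unit (source γ)).symm = γ
  unit_comp : ∀ γ, comp (unit (range γ)) γ (source_unit (range γ)) = γ
  source_inv : ∀ γ, source (inv γ) = range γ
  range_inv : ∀ γ, range (inv γ) = source γ
  comp_inv : ∀ γ, comp γ (inv γ) (range_inv γ).symm = unit (range γ)
  inv_comp : ∀ γ, comp (inv γ) γ (source_inv γ) = unit (source γ)
  isEmbedding_unit : IsEmbedding unit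
  continuous_comp :
    Continuous fun p : {p : Γ × Γ // source p.1 = range p.2} => comp p.1.1 p.1.2 p.2
  continuous_inv : Continuous inv
  isLocalHomeomorph_source : IsLocalHomeomorph source
  isLocalHomeomorph_range : IsLocalHomeomorph range

namespace EtaleGroupoid

variable {X Γ : Type*} [TopologicalSpace X] [TopologicalSpace Γ] (𝒢 : EtaleGroupoid X Γ)

/-- The orbit of a unit. -/
def orbit (x : X) : Set X := 𝒢.range '' {γ | 𝒢.source γ = x}

/-- Every orbit is dense in the unit space. -/
def IsMinimal : Prop := ∀ x, Dense (𝒢.orbit x)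

/-- A bisection: an open set of arrows on which source and range are injective.  As source and
range are continuous and open, they restrict to homeomorphisms from the bisection onto open
subsets of the unit space. -/
structure IsBisection (T : Set Γ) : Prop where
  isOpen : IsOpen T
  injOn_source : InjOn 𝒢.source T
  injOn_range : InjOn 𝒢.range T

/-- The graph of the partial homeomorphism `range ∘ (source|_T)⁻¹` of `X` defined by a
bisection `T`. -/
def graph (T : Set Γ) : Set (X × X) := (fun γ => (𝒢.source γ, 𝒢.range γ)) '' T

/-- Every bisection is determined by the partial homeomorphism of the unit space it defines. -/
def IsEffective : Prop :=
  ∀ T T' : Set Γ, 𝒢.IsBisection T → 𝒢.IsBisection T' → 𝒢.graph T = 𝒢.graph T' → T = T'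

/-- The product `T S = {γ δ : γ ∈ T, δ ∈ S, s(γ) = r(δ)}` of two sets of arrows. -/
def setMul (T S : Set Γ) : Set Γ := {ε | ∃ γ ∈ T, ∃ δ ∈ S, ∃ h, 𝒢.comp γ δ h = ε}

/-- The (topological) full group: bisections whose source and range are the whole unit space. -/
@[ext]
structure FullGroup where
  carrier : Set Γ
  isBisection : 𝒢.IsBisection carrier
  source_image : 𝒢.source '' carrier = univ
  range_image : 𝒢.range '' carrier = univ

variable {𝒢}

theorem inv_inv (γ : Γ) : 𝒢.inv (𝒢.inv γ) = γ := by
  have h := 𝒢.comp_assoc (𝒢.inv (𝒢.inv γ)) (𝒢.inv γ) γ (𝒢.source_inv _) (𝒢.source_inv _)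
  have e : ∀ a b c (h : 𝒢.source a = 𝒢.range c) (h' : 𝒢.source b = 𝒢.range c), a = b →
      𝒢.comp a c h = 𝒢.comp b c h' := by rintro a _ c h h' rfl; rfl
  have e' : ∀ a b c (h : 𝒢.source c = 𝒢.range a) (h' : 𝒢.source c = 𝒢.range b), a = b →
      𝒢.comp c a h = 𝒢.comp c b h' := by rintro a _ c h h' rfl; rfl
  have hs : 𝒢.source (𝒢.inv γ) = 𝒢.range γ := 𝒢.source_inv γ
  have hs' : 𝒢.source (𝒢.inv (𝒢.inv γ)) = 𝒢.source γ := by rw [𝒢.source_inv, 𝒢.range_inv]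
  rw [e _ (𝒢.unit (𝒢.range γ)) γ _ (𝒢.source_unit _) (by rw [𝒢.inv_comp, hs]), 𝒢.unit_comp,
    e' _ (𝒢.unit (𝒢.source (𝒢.inv (𝒢.inv γ)))) _ _ (𝒢.range_unit _).symm
      (by rw [𝒢.inv_comp, hs']), 𝒢.comp_unit] at h
  exact h.symm

theorem comp_congr {γ γ' δ δ' : Γ} (hγ : γ = γ') (hδ : δ = δ') (h : 𝒢.source γ = 𝒢.range δ) :
    𝒢.comp γ δ h = 𝒢.comp γ' δ' (hγ ▸ hδ ▸ h) := by
  subst hγ hδ; rfl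

theorem isOpen_range_unit : IsOpen (Set.range 𝒢.unit) := by
  rw [isOpen_iff_forall_mem_open]
  rintro _ ⟨x, rfl⟩
  obtain ⟨e, hx, he⟩ := 𝒢.isLocalHomeomorph_source (𝒢.unit x)
  have hc : Continuous 𝒢.source := 𝒢.isLocalHomeomorph_source.continuous
  refine ⟨e.source ∩ (fun γ => 𝒢.unit (𝒢.source γ)) ⁻¹' e.source, ?_,
    e.open_source.inter (e.open_source.preimage (𝒢.isEmbedding_unit.continuous.comp hc)),
    hx, by simpa [𝒢.source_unit] using hx⟩
  rintro γ ⟨h₁, h₂⟩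
  refine ⟨𝒢.source γ, ?_⟩
  have h := e.injOn h₂ h₁
  rw [← he] at h
  exact h (𝒢.source_unit _)

namespace FullGroup

theorem exists_mem_source (g : 𝒢.FullGroup) (x : X) : ∃ γ ∈ g.carrier, 𝒢.source γ = x := by
  have : x ∈ 𝒢.source '' g.carrier := by rw [g.source_image]; trivial
  exact this

theorem exists_mem_range (g : 𝒢.FullGroup) (x : X) : ∃ γ ∈ g.carrier, 𝒢.range γ = x := by
  have : x ∈ 𝒢.range '' g.carrier := by rw [g.range_image]; trivial
  exact this

/-- The germ of `g` at `x`: the unique arrow of `g` with source `x`. -/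
noncomputable def germ (g : 𝒢.FullGroup) (x : X) : Γ := (g.exists_mem_source x).choose

theorem germ_mem (g : 𝒢.FullGroup) (x : X) : g.germ x ∈ g.carrier :=
  (g.exists_mem_source x).choose_spec.1

theorem source_germ (g : 𝒢.FullGroup) (x : X) : 𝒢.source (g.germ x) = x :=
  (g.exists_mem_source x).choose_spec.2

theorem germ_eq (g : 𝒢.FullGroup) {x : X} {γ : Γ} (hγ : γ ∈ g.carrier) (h : 𝒢.source γ = x) :
    g.germ x = γ :=
  g.isBisection.injOn_source (g.germ_mem x) hγ ((g.source_germ x).trans h.symm)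

theorem continuous_germ (g : 𝒢.FullGroup) : Continuous g.germ := by
  rw [continuous_def]
  intro s hs
  have : g.germ ⁻¹' s = 𝒢.source '' (s ∩ g.carrier) := by
    ext x
    constructor
    · intro hx
      exact ⟨g.germ x, ⟨hx, g.germ_mem x⟩, g.source_germ x⟩
    · rintro ⟨γ, ⟨h₁, h₂⟩, rfl⟩
      simpa [g.germ_eq h₂ rfl] using h₁
  rw [this]
  exact 𝒢.isLocalHomeomorph_source.isOpenMap _ (hs.inter g.isBisection.isOpen)

theorem isOpen_setMul (g h : 𝒢.FullGroup) : IsOpen (𝒢.setMul g.carrier h.carrier) := by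
  have hc : Continuous 𝒢.source := 𝒢.isLocalHomeomorph_source.continuous
  have hp : ∀ ε, 𝒢.source ε = 𝒢.range (𝒢.inv (h.germ (𝒢.source ε))) := fun ε => by
    rw [𝒢.range_inv, h.source_germ]
  let f : Γ → Γ := fun ε => 𝒢.comp ε (𝒢.inv (h.germ (𝒢.source ε))) (hp ε)
  have hf : Continuous f := 𝒢.continuous_comp.comp
    (Continuous.subtype_mk (continuous_id.prodMk
      (𝒢.continuous_inv.comp (h.continuous_germ.comp hc))) hp)
  have : 𝒢.setMul g.carrier h.carrier = f ⁻¹' g.carrier := by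
    ext ε
    constructor
    · rintro ⟨γ, hγ, δ, hδ, e, rfl⟩
      have hδ' : h.germ (𝒢.source (𝒢.comp γ δ e)) = δ :=
        h.germ_eq hδ (𝒢.source_comp _ _ _).symm
      change f _ ∈ g.carrier
      have : f (𝒢.comp γ δ e) = γ := by
        change 𝒢.comp _ _ _ = γ
        rw [comp_congr rfl (congrArg 𝒢.inv hδ'), 𝒢.comp_assoc γ δ _ e (𝒢.range_inv _).symm,
          comp_congr rfl (𝒢.comp_inv δ), comp_congr rfl (congrArg 𝒢.unit e.symm), 𝒢.comp_unit]
      rwa [this]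
    · intro hε
      have e : 𝒢.source (f ε) = 𝒢.range (h.germ (𝒢.source ε)) := by
        rw [𝒢.source_comp, 𝒢.source_inv]
      refine ⟨f ε, hε, h.germ (𝒢.source ε), h.germ_mem _, e, ?_⟩
      rw [𝒢.comp_assoc ε _ _ (hp ε) (𝒢.source_inv _), comp_congr rfl (𝒢.inv_comp _),
        comp_congr rfl (congrArg 𝒢.unit (h.source_germ _)), 𝒢.comp_unit]
  rw [this]
  exact g.isBisection.isOpen.preimage hf

instance : Mul 𝒢.FullGroup where
  mul g h :=
    { carrier := 𝒢.setMul g.carrier h.carrier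
      isBisection := by
        refine ⟨g.isOpen_setMul h, ?_, ?_⟩
        · rintro _ ⟨γ, hγ, δ, hδ, e, rfl⟩ _ ⟨γ', hγ', δ', hδ', e', rfl⟩ hs
          rw [𝒢.source_comp, 𝒢.source_comp] at hs
          obtain rfl := h.isBisection.injOn_source hδ hδ' hs
          obtain rfl := g.isBisection.injOn_source hγ hγ' (e.trans e'.symm)
          rfl
        · rintro _ ⟨γ, hγ, δ, hδ, e, rfl⟩ _ ⟨γ', hγ', δ', hδ', e', rfl⟩ hs
          rw [𝒢.range_comp, 𝒢.range_comp] at hs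
          obtain rfl := g.isBisection.injOn_range hγ hγ' hs
          obtain rfl := h.isBisection.injOn_range hδ hδ' (e.symm.trans e')
          rfl
      source_image := by
        refine eq_univ_of_forall fun x => ?_
        have e := g.source_germ (𝒢.range (h.germ x))
        exact ⟨_, ⟨_, g.germ_mem _, _, h.germ_mem x, e, rfl⟩,
          (𝒢.source_comp _ _ _).trans (h.source_germ x)⟩
      range_image := by
        refine eq_univ_of_forall fun x => ?_
        obtain ⟨γ, hγ, rfl⟩ := g.exists_mem_range x
        obtain ⟨δ, hδ, e⟩ := h.exists_mem_range (𝒢.source γ)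
        exact ⟨_, ⟨γ, hγ, δ, hδ, e.symm, rfl⟩, 𝒢.range_comp _ _ _⟩ }

instance : One 𝒢.FullGroup where
  one :=
    { carrier := Set.range 𝒢.unit
      isBisection := by
        refine ⟨isOpen_range_unit, ?_, ?_⟩
        · rintro _ ⟨x, rfl⟩ _ ⟨y, rfl⟩ h
          rw [𝒢.source_unit, 𝒢.source_unit] at h
          rw [h]
        · rintro _ ⟨x, rfl⟩ _ ⟨y, rfl⟩ h
          rw [𝒢.range_unit, 𝒢.range_unit] at h
          rw [h]
      source_image := eq_univ_of_forall fun x => ⟨_, ⟨x, rfl⟩, 𝒢.source_unit x⟩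
      range_image := eq_univ_of_forall fun x => ⟨_, ⟨x, rfl⟩, 𝒢.range_unit x⟩ }

/-- The inverse `{γ⁻¹ : γ ∈ g}`. -/
instance : Inv 𝒢.FullGroup where
  inv g :=
    { carrier := 𝒢.inv '' g.carrier
      isBisection := by
        have : 𝒢.inv '' g.carrier = 𝒢.inv ⁻¹' g.carrier := by
          ext γ
          constructor
          · rintro ⟨δ, hδ, rfl⟩
            simpa [EtaleGroupoid.inv_inv] using hδ
          · intro hγ
            exact ⟨_, hγ, EtaleGroupoid.inv_inv γ⟩
        refine ⟨this ▸ g.isBisection.isOpen.preimage 𝒢.continuous_inv, ?_, ?_⟩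
        · rintro _ ⟨γ, hγ, rfl⟩ _ ⟨γ', hγ', rfl⟩ h
          rw [𝒢.source_inv, 𝒢.source_inv] at h
          rw [g.isBisection.injOn_range hγ hγ' h]
        · rintro _ ⟨γ, hγ, rfl⟩ _ ⟨γ', hγ', rfl⟩ h
          rw [𝒢.range_inv, 𝒢.range_inv] at h
          rw [g.isBisection.injOn_source hγ hγ' h]
      source_image := by
        rw [image_image, ← g.range_image]
        exact image_congr fun γ _ => 𝒢.source_inv γ
      range_image := by
        rw [image_image, ← g.source_image]
        exact image_congr fun γ _ => 𝒢.range_inv γ }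

theorem carrier_mul (g h : 𝒢.FullGroup) : (g * h).carrier = 𝒢.setMul g.carrier h.carrier := rfl

theorem carrier_one : (1 : 𝒢.FullGroup).carrier = Set.range 𝒢.unit := rfl

theorem carrier_inv (g : 𝒢.FullGroup) : g⁻¹.carrier = 𝒢.inv '' g.carrier := rfl

instance : Group 𝒢.FullGroup where
  mul_assoc a b c := by
    apply FullGroup.ext
    simp only [carrier_mul]
    ext ε
    constructor
    · rintro ⟨_, ⟨γ, hγ, δ, hδ, e, rfl⟩, κ, hκ, e', rfl⟩
      have e'' := (𝒢.source_comp γ δ e).symm.trans e'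
      exact ⟨γ, hγ, _, ⟨δ, hδ, κ, hκ, e'', rfl⟩, _, (𝒢.comp_assoc γ δ κ e e'').symm⟩
    · rintro ⟨γ, hγ, _, ⟨δ, hδ, κ, hκ, e', rfl⟩, e, rfl⟩
      have e'' := e.trans (𝒢.range_comp δ κ e')
      exact ⟨_, ⟨γ, hγ, δ, hδ, e'', rfl⟩, κ, hκ, _, 𝒢.comp_assoc γ δ κ e'' e'⟩
  one_mul a := by
    apply FullGroup.ext
    simp only [carrier_mul, carrier_one]
    ext ε
    constructor
    · rintro ⟨_, ⟨x, rfl⟩, δ, hδ, e, rfl⟩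
      obtain rfl : x = 𝒢.range δ := (𝒢.source_unit x).symm.trans e
      rwa [𝒢.unit_comp]
    · intro hε
      exact ⟨_, ⟨_, rfl⟩, ε, hε, 𝒢.source_unit _, 𝒢.unit_comp ε⟩
  mul_one a := by
    apply FullGroup.ext
    simp only [carrier_mul, carrier_one]
    ext ε
    constructor
    · rintro ⟨γ, hγ, _, ⟨x, rfl⟩, e, rfl⟩
      obtain rfl : 𝒢.source γ = x := e.trans (𝒢.range_unit x)
      rwa [𝒢.comp_unit]
    · intro hε
      exact ⟨ε, hε, _, ⟨_, rfl⟩, (𝒢.range_unit _).symm, 𝒢.comp_unit ε⟩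
  inv_mul_cancel a := by
    apply FullGroup.ext
    simp only [carrier_mul, carrier_one, carrier_inv]
    ext ε
    constructor
    · rintro ⟨_, ⟨γ, hγ, rfl⟩, δ, hδ, e, rfl⟩
      obtain rfl := a.isBisection.injOn_range hγ hδ ((𝒢.source_inv γ).symm.trans e)
      exact ⟨_, (𝒢.inv_comp γ).symm⟩
    · rintro ⟨x, rfl⟩
      refine ⟨_, ⟨_, a.germ_mem x, rfl⟩, _, a.germ_mem x, 𝒢.source_inv _, ?_⟩
      rw [𝒢.inv_comp, a.source_germ]

/-- The action of the full group on the unit space: `g` maps the source of each of its arrows to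
the range of that arrow. -/
noncomputable instance : MulAction 𝒢.FullGroup X where
  smul g x := 𝒢.range (g.germ x)
  one_smul x := by
    change 𝒢.range (germ 1 x) = x
    rw [germ_eq (1 : 𝒢.FullGroup) (γ := 𝒢.unit x) ⟨x, rfl⟩ (𝒢.source_unit x), 𝒢.range_unit]
  mul_smul g h x := by
    change 𝒢.range ((g * h).germ x) = 𝒢.range (g.germ (𝒢.range (h.germ x)))
    have e := g.source_germ (𝒢.range (h.germ x))
    rw [(g * h).germ_eq (γ := 𝒢.comp _ _ e) ⟨_, g.germ_mem _, _, h.germ_mem x, e, rfl⟩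
      ((𝒢.source_comp _ _ _).trans (h.source_germ x)), 𝒢.range_comp]

end FullGroup

variable (𝒢)

/-- A multisection of degree `d`.  The sets `F i i` are compact open subsets of the unit space,
seen as sets of unit arrows (openness is part of being a bisection). -/
structure Multisection (d : ℕ) where
  toFun : Fin d → Fin d → Set Γ
  isBisection : ∀ i j, 𝒢.IsBisection (toFun i j)
  diag_subset : ∀ i, toFun i i ⊆ Set.range 𝒢.unit
  isCompact_diag : ∀ i, IsCompact (toFun i i)
  disjoint_diag : ∀ i j, i ≠ j → Disjoint (toFun i i) (toFun j j)
  setMul_eq : ∀ i j k, 𝒢.setMul (toFun i j) (toFun j k) = toFun i k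

/-- The set of arrows `(⋃ᵢ F(σ(i), i)) ∪ (X ∖ ⋃ᵢ F(i, i))`. -/
def Multisection.perm {𝒢 : EtaleGroupoid X Γ} {d : ℕ} (F : 𝒢.Multisection d)
    (σ : Equiv.Perm (Fin d)) : Set Γ :=
  (⋃ i, F.toFun (σ i) i) ∪ (Set.range 𝒢.unit \ ⋃ i, F.toFun i i)

/-- The alternating full group: the subgroup of the full group generated by the bisections `F(σ)`,
for `F` a multisection of degree `d ≥ 3` and `σ` an even permutation of the `d` indices. -/
def alternatingFullGroup : Subgroup 𝒢.FullGroup :=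
  Subgroup.closure {g | ∃ d : ℕ, 3 ≤ d ∧ ∃ F : 𝒢.Multisection d,
    ∃ σ ∈ alternatingGroup (Fin d), g.carrier = F.perm σ}

end EtaleGroupoid

/-- The germ-stabiliser of `Q` in `A`: elements of `A` that fix pointwise a neighbourhood
of `Q`. -/
def germStabilizer {G X : Type*} [Group G] [MulAction G X] [TopologicalSpace X]
    (A : Subgroup G) (Q : Set X) : Subgroup G where
  carrier := {g | g ∈ A ∧ ∃ U : Set X, IsOpen U ∧ Q ⊆ U ∧ ∀ x ∈ U, g • x = x}
  one_mem' := ⟨A.one_mem, univ, isOpen_univ, subset_univ _, fun x _ => one_smul G x⟩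
  mul_mem' := by
    rintro a b ⟨ha, U, hU, hQU, hU'⟩ ⟨hb, V, hV, hQV, hV'⟩
    exact ⟨A.mul_mem ha hb, U ∩ V, hU.inter hV, subset_inter hQU hQV,
      fun x hx => by rw [mul_smul, hV' x hx.2, hU' x hx.1]⟩
  inv_mem' := by
    rintro a ⟨ha, U, hU, hQU, hU'⟩
    exact ⟨A.inv_mem ha, U, hU, hQU, fun x hx => by rw [inv_smul_eq_iff, hU' x hx]⟩

open Classical in
/-- The Chabauty topology on the set of subgroups of a discrete group, induced by the product
topology on `{0,1}^G`. -/
@[reducible]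
noncomputable def chabautyTopology (G : Type*) [Group G] : TopologicalSpace (Subgroup G) :=
  TopologicalSpace.induced (fun (H : Subgroup G) (g : G) => decide (g ∈ H))
    (Pi.topologicalSpace : TopologicalSpace (G → Bool))

/-- The conjugate `a H a⁻¹`. -/
def conjSubgroup {G : Type*} [Group G] (a : G) (H : Subgroup G) : Subgroup G :=
  H.map (MulAut.conj a).toMonoidHom

/-- `H` is confined by `A`: the trivial subgroup is not in the Chabauty closure of
`{a H a⁻¹ : a ∈ A}`. -/
def IsConfinedBy {G : Type*} [Group G] (A H : Subgroup G) : Prop :=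
  ⊥ ∉ @closure (Subgroup G) (chabautyTopology G) {K | ∃ a ∈ A, K = conjSubgroup a H}

/-- `H` is confined: it is confined by the whole group. -/
def IsConfined {G : Type*} [Group G] (H : Subgroup G) : Prop :=
  IsConfinedBy ⊤ H

/-- The finite set `P` of non-trivial elements is a confining set for `H` relative to `A`. -/
def IsConfiningSet {G : Type*} [Group G] (A H : Subgroup G) (P : Finset G) : Prop :=
  1 ∉ P ∧ ∀ a ∈ A, ∃ p ∈ P, p ∈ conjSubgroup a H

/-- `X` is a Cantor space. -/
def IsCantorSpace (X : Type*) [TopologicalSpace X] : Prop :=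
  Nonempty (X ≃ₜ (ℕ → Bool))

/-- `X` is a locally compact, non-compact Cantor space: it is homeomorphic to an open, non-closed
subset of a Cantor space. -/
def IsLocallyCompactCantorSpace (X : Type*) [TopologicalSpace X] : Prop :=
  ∃ U : Set (ℕ → Bool), IsOpen U ∧ ¬ IsClosed U ∧ Nonempty (X ≃ₜ U)

/-!
By effectiveness, the full group acts faithfully on `X`, and a permutation of `X` which locally
agrees with elements of the full group belongs to it. Arrows between different units lie in
elements of the full group, so its orbits are dense, and the alternating full group is generated
by the 3-cycles of compact open sets (`IsCyc`, `alternatingFullGroup_eq`). The theorem holds for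
every group `G` with such an action; `alt G U` denotes the group generated by the 3-cycles supported
in an open set `U`.

Confined means that some finite set `P` of nontrivial elements meets all conjugates of `H`. Let the
elements of `P` displace pairwise disjoint small open sets `D p`. By B. H. Neumann's lemma on
coverings by cosets, and since `alt G U` has no proper subgroup of finite index, for some `p ∈ P`
every element of `alt G (D p)` agrees on `D p` with an element of `H` whose support is otherwise
small (`exists_forall_exists_smul_eq`). Comparing two positions of the sets `D p` and taking
commutators, which is harmless as `alt G U` is perfect, one finds a nonempty open `V` with
`alt G V ≤ H` (`exists_alt_le`).

As `alt G U` and `alt G V` generate a group containing `alt G (U ∪ V)` when `U` and `V` overlap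
(`alt_union_le`), there is a largest open set `U ⊇ V` with `alt G U ≤ H`, and it is a block for the
action of `H`. If the complement had at least `P.card` points, then, by multiple transitivity,
some conjugate of `H` would avoid `P` (`card_lt_of_forall_preserve`). Hence the complement is a
finite set `Q`, which `H` preserves; the same argument gives the bound on the cardinality.

Finally, an element of `alt G univ` which is trivial near `Q` lies in `alt G Qᶜ`
(`mem_alt_diff_of_eventually`), so that `H` contains the germ stabilizer of `Q`. Conversely, a
germ stabilizer of `Q` is confined by any `Q.card + 1` disjointly supported 3-cycles.
-/

open Filter MulAction

/-! ### 3-cycles of compact open sets -/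

/-- The action of `G` on `X` is full: a permutation of `X` which locally agrees with elements of
`G` is itself given by an element of `G`. -/
class IsFullAction (G X : Type*) [Group G] [TopologicalSpace X] [MulAction G X] : Prop where
  exists_smul_eq : ∀ φ : Equiv.Perm X, (∀ x, ∃ g : G, ∀ᶠ y in 𝓝 x, φ y = g • y) →
    ∃ g : G, ∀ x, g • x = φ x

/-- `t` is the 3-cycle of the sets `a • D → b • D → c • D → a • D`, where `D` is compact open and
the three sets are pairwise disjoint: it is the identity elsewhere and moves these sets through
the given elements `a`, `b`, `c`. -/
structure IsCyc {G X : Type*} [Group G] [TopologicalSpace X] [MulAction G X]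
    (D : Set X) (a b c t : G) : Prop where
  isCompact : IsCompact D
  isOpen : IsOpen D
  ne_ab : ∀ x ∈ D, ∀ y ∈ D, a • x ≠ b • y
  ne_bc : ∀ x ∈ D, ∀ y ∈ D, b • x ≠ c • y
  ne_ca : ∀ x ∈ D, ∀ y ∈ D, c • x ≠ a • y
  map_a : ∀ x ∈ D, t • a • x = b • x
  map_b : ∀ x ∈ D, t • b • x = c • x
  map_c : ∀ x ∈ D, t • c • x = a • x
  map_of_ne : ∀ y, (∀ x ∈ D, a • x ≠ y) → (∀ x ∈ D, b • x ≠ y) → (∀ x ∈ D, c • x ≠ y) → t • y = y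

/-- `t` is a 3-cycle supported in `U`. -/
def IsCycIn {G X : Type*} [Group G] [TopologicalSpace X] [MulAction G X] (U : Set X) (t : G) :
    Prop :=
  (∃ (D : Set X) (a b c : G), IsCyc D a b c t) ∧ ∀ y ∉ U, t • y = y

/-- The subgroup generated by the 3-cycles supported in `U`. -/
def alt (G : Type*) {X : Type*} [Group G] [TopologicalSpace X] [MulAction G X] (U : Set X) :
    Subgroup G :=
  Subgroup.closure {t | IsCycIn U t}

section Basic

variable {G X : Type*} [Group G] [TopologicalSpace X] [MulAction G X]

namespace IsCyc

variable {D D' : Set X} {a b c t k : G}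

theorem rotate (h : IsCyc D a b c t) : IsCyc D b c a t :=
  ⟨h.isCompact, h.isOpen, h.ne_bc, h.ne_ca, h.ne_ab, h.map_b, h.map_c, h.map_a,
    fun y h₁ h₂ h₃ => h.map_of_ne y h₃ h₁ h₂⟩

theorem conj (h : IsCyc D a b c t) (k : G) :
    IsCyc D (k * a) (k * b) (k * c) (k * t * k⁻¹) := by
  refine ⟨h.isCompact, h.isOpen, ?_, ?_, ?_, ?_, ?_, ?_, ?_⟩
  · intro x hx y hy; simpa [mul_smul] using h.ne_ab x hx y hy
  · intro x hx y hy; simpa [mul_smul] using h.ne_bc x hx y hy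
  · intro x hx y hy; simpa [mul_smul] using h.ne_ca x hx y hy
  · intro x hx; simpa [mul_smul] using h.map_a x hx
  · intro x hx; simpa [mul_smul] using h.map_b x hx
  · intro x hx; simpa [mul_smul] using h.map_c x hx
  · intro y h₁ h₂ h₃
    have := h.map_of_ne (k⁻¹ • y) (fun x hx e => h₁ x hx (by simp [mul_smul, e]))
      (fun x hx e => h₂ x hx (by simp [mul_smul, e]))
      (fun x hx e => h₃ x hx (by simp [mul_smul, e]))
    simp [mul_smul, this]

theorem inv (h : IsCyc D a b c t) : IsCyc D a c b t⁻¹ := by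
  refine ⟨h.isCompact, h.isOpen, fun x hx y hy => (h.ne_ca y hy x hx).symm,
    fun x hx y hy => (h.ne_bc y hy x hx).symm, fun x hx y hy => (h.ne_ab y hy x hx).symm, ?_, ?_,
    ?_, ?_⟩
  · intro x hx; rw [inv_smul_eq_iff, h.map_c x hx]
  · intro x hx; rw [inv_smul_eq_iff, h.map_b x hx]
  · intro x hx; rw [inv_smul_eq_iff, h.map_a x hx]
  · intro y h₁ h₂ h₃; rw [inv_smul_eq_iff, h.map_of_ne y h₁ h₃ h₂]

theorem congr {a' b' c' : G} (h : IsCyc D a b c t) (ha : ∀ x ∈ D, a' • x = a • x)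
    (hb : ∀ x ∈ D, b' • x = b • x) (hc : ∀ x ∈ D, c' • x = c • x) : IsCyc D a' b' c' t := by
  refine ⟨h.isCompact, h.isOpen, ?_, ?_, ?_, ?_, ?_, ?_, ?_⟩
  · intro x hx y hy; rw [ha x hx, hb y hy]; exact h.ne_ab x hx y hy
  · intro x hx y hy; rw [hb x hx, hc y hy]; exact h.ne_bc x hx y hy
  · intro x hx y hy; rw [hc x hx, ha y hy]; exact h.ne_ca x hx y hy
  · intro x hx; rw [ha x hx, hb x hx, h.map_a x hx]
  · intro x hx; rw [hb x hx, hc x hx, h.map_b x hx]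
  · intro x hx; rw [hc x hx, ha x hx, h.map_c x hx]
  · intro y h₁ h₂ h₃
    exact h.map_of_ne y (fun x hx => ha x hx ▸ h₁ x hx) (fun x hx => hb x hx ▸ h₂ x hx)
      (fun x hx => hc x hx ▸ h₃ x hx)

/-- The base of a 3-cycle may be chosen to be the first of the three sets it permutes. -/
theorem rebase [ContinuousConstSMul G X] (h : IsCyc D a b c t) : IsCyc (a • D) 1 t (t * t) t := by
  have h' : IsCyc (a • D) 1 (b * a⁻¹) (c * a⁻¹) t := by
    refine ⟨h.isCompact.smul a, h.isOpen.smul a, ?_, ?_, ?_, ?_, ?_, ?_, ?_⟩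
    · rintro _ ⟨x, hx, rfl⟩ _ ⟨y, hy, rfl⟩; simpa [mul_smul] using h.ne_ab x hx y hy
    · rintro _ ⟨x, hx, rfl⟩ _ ⟨y, hy, rfl⟩; simpa [mul_smul] using h.ne_bc x hx y hy
    · rintro _ ⟨x, hx, rfl⟩ _ ⟨y, hy, rfl⟩; simpa [mul_smul] using h.ne_ca x hx y hy
    · rintro _ ⟨x, hx, rfl⟩; simpa [mul_smul] using h.map_a x hx
    · rintro _ ⟨x, hx, rfl⟩; simpa [mul_smul] using h.map_b x hx
    · rintro _ ⟨x, hx, rfl⟩; simpa [mul_smul] using h.map_c x hx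
    · intro y h₁ h₂ h₃
      exact h.map_of_ne y (fun x hx => by simpa using h₁ _ ⟨x, hx, rfl⟩)
        (fun x hx => by simpa [mul_smul] using h₂ _ ⟨x, hx, rfl⟩)
        (fun x hx => by simpa [mul_smul] using h₃ _ ⟨x, hx, rfl⟩)
  refine h'.congr (fun _ _ => rfl) ?_ ?_
  · rintro _ ⟨x, hx, rfl⟩
    simp [mul_smul, h.map_a x hx]
  · rintro _ ⟨x, hx, rfl⟩
    simp [mul_smul, h.map_a x hx, h.map_b x hx]

/-- Two 3-cycles of the same sets through the same elements are equal. -/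
theorem smul_eq {t' : G} (h : IsCyc D a b c t) (h' : IsCyc D a b c t') (y : X) :
    t • y = t' • y := by
  by_cases h₁ : ∃ x ∈ D, a • x = y
  · obtain ⟨x, hx, rfl⟩ := h₁; rw [h.map_a x hx, h'.map_a x hx]
  by_cases h₂ : ∃ x ∈ D, b • x = y
  · obtain ⟨x, hx, rfl⟩ := h₂; rw [h.map_b x hx, h'.map_b x hx]
  by_cases h₃ : ∃ x ∈ D, c • x = y
  · obtain ⟨x, hx, rfl⟩ := h₃; rw [h.map_c x hx, h'.map_c x hx]
  push Not at h₁ h₂ h₃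
  rw [h.map_of_ne y h₁ h₂ h₃, h'.map_of_ne y h₁ h₂ h₃]

/-- A point moved by a 3-cycle lies in one of the three sets; after rotating, in the first one. -/
theorem exists_rotate (h : IsCyc D a b c t) {y : X} (hy : t • y ≠ y) :
    ∃ a' b' c' : G, IsCyc D a' b' c' t ∧ ∃ x ∈ D, a' • x = y := by
  by_cases h₁ : ∃ x ∈ D, a • x = y
  · exact ⟨a, b, c, h, h₁⟩
  by_cases h₂ : ∃ x ∈ D, b • x = y
  · exact ⟨b, c, a, h.rotate, h₂⟩
  by_cases h₃ : ∃ x ∈ D, c • x = y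
  · exact ⟨c, a, b, h.rotate.rotate, h₃⟩
  push Not at h₁ h₂ h₃
  exact absurd (h.map_of_ne y h₁ h₂ h₃) hy

theorem moves (h : IsCyc D a b c t) {x : X} (hx : x ∈ D) : t • a • x ≠ a • x := by
  rw [h.map_a x hx]; exact (h.ne_ab x hx x hx).symm

theorem map_of_not_moved (h : IsCyc D a b c t) {t' : G} {D' : Set X}
    (hD : D' ⊆ D) (h' : IsCyc D' a b c t') {y : X} (hy : t • y = y) : t' • y = y := by
  by_contra hne
  by_cases h₁ : ∃ x ∈ D', a • x = y
  · obtain ⟨x, hx, rfl⟩ := h₁; exact h.moves (hD hx) hy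
  by_cases h₂ : ∃ x ∈ D', b • x = y
  · obtain ⟨x, hx, rfl⟩ := h₂; exact h.rotate.moves (hD hx) hy
  by_cases h₃ : ∃ x ∈ D', c • x = y
  · obtain ⟨x, hx, rfl⟩ := h₃; exact h.rotate.rotate.moves (hD hx) hy
  push Not at h₁ h₂ h₃
  exact hne (h'.map_of_ne y h₁ h₂ h₃)

/-- The product of 3-cycles of `a • D`, `b • D`, `c • D` and of `b • D`, `d • D`, `c • D`. -/
theorem mul {d s : G} (hs : IsCyc D a b c s) (ht : IsCyc D b d c t)
    (hd : ∀ x ∈ D, ∀ y ∈ D, a • x ≠ d • y) : IsCyc D a d c (t * s) := by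
  refine ⟨hs.isCompact, hs.isOpen, hd, ht.ne_bc, hs.ne_ca, ?_, ?_, ?_, ?_⟩
  · intro x hx; rw [mul_smul, hs.map_a x hx, ht.map_a x hx]
  · intro x hx
    rw [mul_smul, hs.map_of_ne _ (fun y hy => hd y hy x hx) (fun y hy => ht.ne_ab y hy x hx)
      (fun y hy => (ht.ne_bc x hx y hy).symm), ht.map_b x hx]
  · intro x hx
    rw [mul_smul, hs.map_c x hx, ht.map_of_ne _ (fun y hy => (hs.ne_ab x hx y hy).symm)
      (fun y hy => (hd x hx y hy).symm) (fun y hy => hs.ne_ca y hy x hx)]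
  · intro y h₁ h₂ h₃
    by_cases h₄ : ∃ x ∈ D, b • x = y
    · obtain ⟨x, hx, rfl⟩ := h₄
      rw [mul_smul, hs.map_b x hx, ht.map_c x hx]
    · push Not at h₄
      rw [mul_smul, hs.map_of_ne y h₁ h₄ h₃, ht.map_of_ne y h₄ h₂ h₃]

/-- Two 3-cycles which agree on the first set and move it to the same second set differ by a
3-cycle which fixes the first set. -/
theorem inv_mul {d s : G} (hs : IsCyc D a b c s) (ht : IsCyc D a b d t)
    (hd : ∀ x ∈ D, ∀ y ∈ D, c • x ≠ d • y) : IsCyc D b d c (s⁻¹ * t) :=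
  (ht.rotate.rotate.mul hs.inv fun x hx y hy => (hd y hy x hx).symm).rotate.rotate

/-- A 3-cycle is the commutator of two 3-cycles whose supports share one set. -/
theorem commutator {d e s u : G} (hs : IsCyc D a b d s) (hu : IsCyc D a c e u)
    (hbc : ∀ x ∈ D, ∀ y ∈ D, b • x ≠ c • y) (hbe : ∀ x ∈ D, ∀ y ∈ D, b • x ≠ e • y)
    (hdc : ∀ x ∈ D, ∀ y ∈ D, d • x ≠ c • y) (hde : ∀ x ∈ D, ∀ y ∈ D, d • x ≠ e • y) :
    IsCyc D a b c (s * u * s⁻¹ * u⁻¹) := by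
  have h : IsCyc D b c e (s * u * s⁻¹) := (hu.conj s).congr
    (fun x hx => by rw [mul_smul, hs.map_a x hx])
    (fun x hx => by
      rw [mul_smul, hs.map_of_ne _ (fun y hy => (hu.ne_ab y hy x hx))
        (fun y hy => hbc y hy x hx) fun y hy => hdc y hy x hx])
    (fun x hx => by
      rw [mul_smul, hs.map_of_ne _ (fun y hy => (hu.ne_ca x hx y hy).symm)
        (fun y hy => hbe y hy x hx) fun y hy => hde y hy x hx])
  exact hu.inv.mul h.rotate.rotate hs.ne_ab

end IsCyc
end Basic

theorem commutator_mul_mul {G : Type*} [Group G] {s r t q : G} (hrt : Commute r t)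
    (hrq : Commute r q) (hqs : Commute q s) :
    s * r * (t * q) * (s * r)⁻¹ * (t * q)⁻¹ = s * t * s⁻¹ * t⁻¹ := by
  have h₁ : s * r * (t * q) = s * t * q * r := by
    rw [mul_assoc, ← mul_assoc r, hrt.eq, mul_assoc t, hrq.eq]; group
  calc s * r * (t * q) * (s * r)⁻¹ * (t * q)⁻¹ = s * t * (q * s⁻¹) * q⁻¹ * t⁻¹ := by rw [h₁]; group
    _ = s * t * s⁻¹ * t⁻¹ := by rw [hqs.inv_right.eq]; group

theorem smul_mem_iff_of_fix {G X : Type*} [Group G] [MulAction G X] {U : Set X} {t : G}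
    (ht : ∀ y ∉ U, t • y = y) {y : X} : t • y ∈ U ↔ y ∈ U := by
  constructor
  · intro h
    by_contra hy
    rw [ht y hy] at h
    exact hy h
  · intro h
    by_contra hy
    exact hy ((smul_left_cancel t (ht _ hy)).symm ▸ h)

theorem infinite_of_isOpen {X : Type*} [TopologicalSpace X] [T1Space X] [PerfectSpace X]
    {U : Set X} (hU : IsOpen U) (hne : U.Nonempty) : U.Infinite := by
  obtain ⟨x, hx⟩ := hne
  exact infinite_of_mem_nhds x (hU.mem_nhds hx)

theorem exists_smul_ne {G X : Type*} [Group G] [MulAction G X] [FaithfulSMul G X] {g : G}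
    (hg : g ≠ 1) : ∃ x : X, g • x ≠ x := by
  by_contra! h
  exact hg (FaithfulSMul.eq_of_smul_eq_smul (α := X) fun y => by rw [h, one_smul])

section AltBasic

variable {G X : Type*} [Group G] [TopologicalSpace X] [MulAction G X] {U V : Set X} {t k : G}

theorem IsCyc.mem_alt {D : Set X} {a b c : G} (h : IsCyc D a b c t) (hU : ∀ y ∉ U, t • y = y) :
    t ∈ alt G U :=
  Subgroup.subset_closure ⟨⟨D, a, b, c, h⟩, hU⟩

theorem smul_eq_of_mem_alt (ht : t ∈ alt G U) : ∀ y ∉ U, t • y = y := by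
  induction ht using Subgroup.closure_induction with
  | mem t ht => exact ht.2
  | one => exact fun y _ => one_smul G y
  | mul s t _ _ hs ht => exact fun y hy => by rw [mul_smul, ht y hy, hs y hy]
  | inv t _ ht => exact fun y hy => by rw [inv_smul_eq_iff, ht y hy]

theorem smul_mem_iff_of_mem_alt (ht : t ∈ alt G U) {y : X} : t • y ∈ U ↔ y ∈ U :=
  smul_mem_iff_of_fix (smul_eq_of_mem_alt ht)

theorem alt_mono (h : U ⊆ V) : alt G U ≤ alt G V :=
  Subgroup.closure_mono fun _ ht => ⟨ht.1, fun y hy => ht.2 y fun hU => hy (h hU)⟩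

theorem conj_mem_alt (ht : t ∈ alt G U) (hk : ∀ y ∈ U, k • y ∈ V) : k * t * k⁻¹ ∈ alt G V := by
  induction ht using Subgroup.closure_induction with
  | mem t ht =>
    obtain ⟨⟨D, a, b, c, h⟩, h'⟩ := ht
    refine (h.conj k).mem_alt fun y hy => ?_
    rw [mul_smul, mul_smul, h' _ fun hU => hy (by simpa using hk _ hU), smul_inv_smul]
  | one => simp
  | mul s t _ _ hs ht => simpa [mul_assoc] using mul_mem hs ht
  | inv t _ ht => simpa [mul_assoc] using inv_mem ht

/-- Elements supported in disjoint sets commute. -/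
theorem commute_of_fix {G X : Type*} [Group G] [MulAction G X] [FaithfulSMul G X] {U V : Set X}
    {t k : G} (ht : ∀ y ∉ U, t • y = y) (hk : ∀ y ∉ V, k • y = y)
    (h : Disjoint U V) : Commute t k := by
  refine FaithfulSMul.eq_of_smul_eq_smul (α := X) fun y => ?_
  rw [mul_smul, mul_smul]
  by_cases hy : y ∈ U
  · rw [hk y (disjoint_left.1 h hy), hk _ (disjoint_left.1 h ((smul_mem_iff_of_fix ht).2 hy))]
  · rw [ht y hy]
    by_cases hy' : y ∈ V
    · rw [ht _ (disjoint_right.1 h ((smul_mem_iff_of_fix hk).2 hy'))]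
    · rw [hk y hy', ht y hy]

theorem IsCycIn.mem_alt {U : Set X} {t : G} (h : IsCycIn U t) : t ∈ alt G U :=
  Subgroup.subset_closure h

theorem IsCycIn.mem_alt_diff {U : Set X} {t : G} {p : X} (h : IsCycIn U t) (hp : t • p = p) :
    t ∈ alt G (U \ {p}) :=
  Subgroup.subset_closure ⟨h.1, fun y hy => by
    by_cases hyp : y = p
    · rw [hyp, hp]
    · exact h.2 y fun hU => hy ⟨hU, hyp⟩⟩

/-- Cutting the base of a 3-cycle into two pieces factors the 3-cycle. -/
theorem IsCyc.eq_mul [FaithfulSMul G X] {D D' : Set X} {a b c t t' t'' : G}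
    (h : IsCyc D a b c t) (hD' : D' ⊆ D) (h' : IsCyc D' a b c t') (h'' : IsCyc (D \ D') a b c t'') :
    t = t' * t'' := by
  refine FaithfulSMul.eq_of_smul_eq_smul (α := X) fun y => ?_
  have e : ∀ {a b c : G}, IsCyc D a b c t → IsCyc D' a b c t' → IsCyc (D \ D') a b c t'' →
      ∀ x ∈ D, t • a • x = t' • t'' • a • x := by
    intro a b c h h' h'' x hx
    by_cases hx' : x ∈ D'
    · rw [h''.map_of_ne, h.map_a x hx, h'.map_a x hx']
      · intro z hz e
        exact hz.2 (smul_left_cancel a e ▸ hx')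
      · exact fun z hz e => h.ne_ab x hx z hz.1 e.symm
      · exact fun z hz e => h.ne_ca z hz.1 x hx e
    · rw [h''.map_a x ⟨hx, hx'⟩, h'.map_of_ne, h.map_a x hx]
      · exact fun z hz => h.ne_ab z (hD' hz) x hx
      · intro z hz e
        exact hx' (smul_left_cancel b e ▸ hz)
      · exact fun z hz e => h.ne_bc x hx z (hD' hz) e.symm
  rw [mul_smul]
  by_cases h₁ : ∃ x ∈ D, a • x = y
  · obtain ⟨x, hx, rfl⟩ := h₁; exact e h h' h'' x hx
  by_cases h₂ : ∃ x ∈ D, b • x = y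
  · obtain ⟨x, hx, rfl⟩ := h₂; exact e h.rotate h'.rotate h''.rotate x hx
  by_cases h₃ : ∃ x ∈ D, c • x = y
  · obtain ⟨x, hx, rfl⟩ := h₃
    exact e h.rotate.rotate h'.rotate.rotate h''.rotate.rotate x hx
  push Not at h₁ h₂ h₃
  rw [h.map_of_ne y h₁ h₂ h₃, h''.map_of_ne y (fun x hx => h₁ x hx.1) (fun x hx => h₂ x hx.1)
    (fun x hx => h₃ x hx.1), h'.map_of_ne y (fun x hx => h₁ x (hD' hx)) (fun x hx => h₂ x (hD' hx))
    (fun x hx => h₃ x (hD' hx))]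

theorem IsCyc.mul_mul_eq_one [FaithfulSMul G X] {D : Set X} {a b c t : G} (h : IsCyc D a b c t) :
    t * (t * t) = 1 := by
  refine FaithfulSMul.eq_of_smul_eq_smul (α := X) fun y => ?_
  rw [mul_smul, mul_smul, one_smul]
  by_cases hy : t • y = y
  · rw [hy, hy, hy]
  · obtain ⟨a, b, c, h, x, hx, rfl⟩ := h.exists_rotate hy
    rw [h.map_a x hx, h.map_b x hx, h.map_c x hx]

theorem eventually_smul_mem [ContinuousConstSMul G X] {x : X} {a : G} {U : Set X}
    (hU : U ∈ 𝓝 (a • x)) :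
    ∀ᶠ D in (𝓝 x).smallSets, ∀ y ∈ D, a • y ∈ U :=
  eventually_smallSets_forall.2 ((continuous_const_smul a).continuousAt.eventually hU)

theorem eventually_smul_ne [T2Space X] [ContinuousConstSMul G X] {x : X} {a b : G}
    (h : a • x ≠ b • x) :
    ∀ᶠ D in (𝓝 x).smallSets, ∀ y ∈ D, ∀ z ∈ D, a • y ≠ b • z := by
  obtain ⟨U, V, hU, hV, hx, hx', hUV⟩ := t2_separation h
  filter_upwards [eventually_smul_mem (hU.mem_nhds hx), eventually_smul_mem (hV.mem_nhds hx')]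
    with D h₁ h₂ y hy z hz e
  exact disjoint_left.1 hUV (h₁ y hy) (e ▸ h₂ z hz)

variable (G) in
theorem exists_smul_mem_notMem [T2Space X] [PerfectSpace X] [MulAction.IsMinimal G X]
    {U : Set X} (hU : IsOpen U) (hne : U.Nonempty) {S : Set X}
    (hS : S.Finite) (x : X) : ∃ g : G, g • x ∈ U ∧ g • x ∉ S := by
  obtain ⟨y, hy⟩ := ((infinite_of_isOpen hU hne).sdiff hS).nonempty
  exact (hU.sdiff hS.isClosed).exists_smul_mem G x ⟨y, hy⟩

theorem isOpen_smul_ne [T2Space X] [ContinuousConstSMul G X] (g : G) :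
    IsOpen {x : X | g • x ≠ x} :=
  isOpen_ne_fun (continuous_const_smul g) continuous_id

theorem IsCyc.inv_mul_mem_alt {E : Set X} {p : X} {b c d s : G} (hs : IsCyc E 1 b c s)
    (ht : IsCyc E 1 b d t) (hsU : ∀ y ∉ U, s • y = y) (htU : ∀ y ∉ U, t • y = y) (hp : p ∈ E)
    (hd : ∀ x ∈ E, ∀ y ∈ E, c • x ≠ d • y) : s⁻¹ * t ∈ alt G (U \ {p}) := by
  refine IsCycIn.mem_alt_diff ⟨⟨_, _, _, _, hs.inv_mul ht hd⟩, fun y hy => ?_⟩ ?_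
  · rw [mul_smul, htU y hy, inv_smul_eq_iff, hsU y hy]
  · have h₁ := hs.map_a p hp
    have h₂ := ht.map_a p hp
    rw [one_smul] at h₁ h₂
    rw [mul_smul, h₂, inv_smul_eq_iff, h₁]

end AltBasic

section CompactOpen

variable {X : Type*} [TopologicalSpace X] [T2Space X] [LocallyCompactSpace X]
  [TotallyDisconnectedSpace X]

theorem exists_isCompact_isOpen {x : X} {p : Set X → Prop} (h : ∀ᶠ D in (𝓝 x).smallSets, p D) :
    ∃ D, IsCompact D ∧ IsOpen D ∧ x ∈ D ∧ p D := by
  obtain ⟨S, hS, hS'⟩ := eventually_smallSets.1 h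
  obtain ⟨K, hK, hKS, hKc⟩ := local_compact_nhds hS
  obtain ⟨E, hE, hxE, hES⟩ := loc_compact_Haus_tot_disc_of_zero_dim.mem_nhds_iff.1 hK
  exact ⟨E, hKc.of_isClosed_subset hE.1 hES, hE.2, hxE, hS' E (hES.trans hKS)⟩

end CompactOpen

section Existence

variable {G X : Type*} [Group G] [TopologicalSpace X] [MulAction G X]
  [T2Space X] [ContinuousConstSMul G X]

theorem IsCyc.eventually_smul_eq {D : Set X} {a b c t : G} (h : IsCyc D a b c t) {p : X}
    (hp : t • p = p) : ∀ᶠ y in 𝓝 p, t • y = y := by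
  have key : ∀ {a b c : G}, IsCyc D a b c t → ∀ᶠ y in 𝓝 p, ∀ x ∈ D, a • x ≠ y := by
    intro a b c h
    have hcl : IsClosed (a • D) := (h.isCompact.smul a).isClosed
    have hpD : p ∉ a • D := by
      rintro ⟨x, hx, rfl⟩
      exact h.moves hx hp
    filter_upwards [hcl.isOpen_compl.mem_nhds hpD] with y hy x hx e
    exact hy ⟨x, hx, e⟩
  filter_upwards [key h, key h.rotate, key h.rotate.rotate] with y h₁ h₂ h₃
  exact h.map_of_ne y h₁ h₂ h₃

theorem IsCycIn.mem_germStabilizer {U : Set X} {t : G} (ht : IsCycIn U t)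
    {Q : Set X} (hQ : Disjoint U Q) : t ∈ germStabilizer (alt G (univ : Set X)) Q := by
  refine ⟨alt_mono (subset_univ _) ht.mem_alt, interior {y | t • y = y}, isOpen_interior,
    fun q hq => mem_interior_iff_mem_nhds.2 ?_,
    fun y hy => interior_subset (s := {y | t • y = y}) hy⟩
  obtain ⟨D, a, b, c, h⟩ := ht.1
  exact h.eventually_smul_eq (ht.2 q (disjoint_right.1 hQ hq))

theorem exists_isCyc [IsFullAction G X] {D : Set X} (hD : IsCompact D) (hD' : IsOpen D)
    {a b c : G} (hab : ∀ x ∈ D, ∀ y ∈ D, a • x ≠ b • y) (hbc : ∀ x ∈ D, ∀ y ∈ D, b • x ≠ c • y)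
    (hca : ∀ x ∈ D, ∀ y ∈ D, c • x ≠ a • y) : ∃ t : G, IsCyc D a b c t := by
  classical
  let f : X → X := fun y => if a⁻¹ • y ∈ D then b • a⁻¹ • y else if b⁻¹ • y ∈ D then c • b⁻¹ • y
    else if c⁻¹ • y ∈ D then a • c⁻¹ • y else y
  have key : ∀ (u v : G), (∀ x ∈ D, ∀ y ∈ D, u • x ≠ v • y) → ∀ y ∈ D, u⁻¹ • v • y ∉ D :=
    fun u v h y hy hy' => h _ hy' y hy (by simp)
  have fa : ∀ x ∈ D, f (a • x) = b • x := fun x hx => by simp [f, hx]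
  have fb : ∀ x ∈ D, f (b • x) = c • x := fun x hx => by simp [f, hx, key a b hab x hx]
  have fc : ∀ x ∈ D, f (c • x) = a • x := fun x hx => by
    simp [f, hx, key b c hbc x hx, key a c (fun x hx y hy => (hca y hy x hx).symm) x hx]
  have fo : ∀ y, a⁻¹ • y ∉ D → b⁻¹ • y ∉ D → c⁻¹ • y ∉ D → f y = y := fun y h₁ h₂ h₃ => by
    simp [f, h₁, h₂, h₃]
  have f3 : ∀ y, f (f (f y)) = y := fun y => by
    by_cases h₁ : a⁻¹ • y ∈ D
    · have := fa _ h₁; rw [smul_inv_smul] at this; rw [this, fb _ h₁, fc _ h₁, smul_inv_smul]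
    by_cases h₂ : b⁻¹ • y ∈ D
    · have := fb _ h₂; rw [smul_inv_smul] at this; rw [this, fc _ h₂, fa _ h₂, smul_inv_smul]
    by_cases h₃ : c⁻¹ • y ∈ D
    · have := fc _ h₃; rw [smul_inv_smul] at this; rw [this, fa _ h₃, fb _ h₃, smul_inv_smul]
    rw [fo y h₁ h₂ h₃, fo y h₁ h₂ h₃, fo y h₁ h₂ h₃]
  let φ : Equiv.Perm X := ⟨f, fun y => f (f y), f3, f3⟩
  have hφ : ∀ y, φ y = f y := fun _ => rfl
  have near : ∀ (u : G) (y : X), u⁻¹ • y ∈ D → ∀ᶠ z in 𝓝 y, u⁻¹ • z ∈ D := fun u y hy =>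
    (continuous_const_smul u⁻¹).continuousAt.eventually (hD'.mem_nhds hy)
  have far : ∀ (u : G) (y : X), u⁻¹ • y ∉ D → ∀ᶠ z in 𝓝 y, u⁻¹ • z ∉ D := fun u y hy =>
    (continuous_const_smul u⁻¹).continuousAt.eventually (hD.isClosed.isOpen_compl.mem_nhds hy)
  obtain ⟨t, ht⟩ := IsFullAction.exists_smul_eq (G := G) φ fun y => by
    by_cases h₁ : a⁻¹ • y ∈ D
    · refine ⟨b * a⁻¹, (near a y h₁).mono fun z hz => ?_⟩
      have := fa _ hz; rw [smul_inv_smul] at this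
      rw [hφ, this, mul_smul]
    by_cases h₂ : b⁻¹ • y ∈ D
    · refine ⟨c * b⁻¹, (near b y h₂).mono fun z hz => ?_⟩
      have := fb _ hz; rw [smul_inv_smul] at this
      rw [hφ, this, mul_smul]
    by_cases h₃ : c⁻¹ • y ∈ D
    · refine ⟨a * c⁻¹, (near c y h₃).mono fun z hz => ?_⟩
      have := fc _ hz; rw [smul_inv_smul] at this
      rw [hφ, this, mul_smul]
    refine ⟨1, ?_⟩
    filter_upwards [far a y h₁, far b y h₂, far c y h₃] with z h₁ h₂ h₃
    rw [hφ, fo z h₁ h₂ h₃, one_smul]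
  refine ⟨t, hD, hD', hab, hbc, hca, fun x hx => ?_, fun x hx => ?_, fun x hx => ?_,
    fun y h₁ h₂ h₃ => ?_⟩
  · rw [ht, hφ, fa x hx]
  · rw [ht, hφ, fb x hx]
  · rw [ht, hφ, fc x hx]
  · rw [ht, hφ, fo y]
    · exact fun h => h₁ _ h (smul_inv_smul _ _)
    · exact fun h => h₂ _ h (smul_inv_smul _ _)
    · exact fun h => h₃ _ h (smul_inv_smul _ _)

theorem IsCyc.restrict [IsFullAction G X] {D D' : Set X} {a b c t : G} (h : IsCyc D a b c t)
    (hD' : D' ⊆ D) (hc : IsCompact D') (ho : IsOpen D') : ∃ t', IsCyc D' a b c t' :=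
  exists_isCyc hc ho (fun x hx y hy => h.ne_ab x (hD' hx) y (hD' hy))
    (fun x hx y hy => h.ne_bc x (hD' hx) y (hD' hy))
    fun x hx y hy => h.ne_ca x (hD' hx) y (hD' hy)

/-- A 3-cycle lies in a subgroup as soon as its restrictions to small pieces of its base do. -/
theorem IsCyc.mem_of_local [LocallyCompactSpace X] [TotallyDisconnectedSpace X]
    [FaithfulSMul G X] [IsFullAction G X] {D : Set X} {a b c t : G}
    (h : IsCyc D a b c t) {N : Subgroup G}
    (hN : ∀ x ∈ D, ∀ᶠ E in (𝓝 x).smallSets, IsCompact E → IsOpen E → E ⊆ D →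
      ∀ t', IsCyc E a b c t' → t' ∈ N) : t ∈ N := by
  -- All restrictions of `t` to pieces of some open and closed neighbourhood of `S` lie in `N`.
  let p : Set X → Prop := fun S => ∃ E, S ⊆ E ∧ IsClopen E ∧ ∀ F, F ⊆ E → IsCompact F → IsOpen F →
    F ⊆ D → ∀ t', IsCyc F a b c t' → t' ∈ N
  have hp : p D := by
    refine h.isCompact.induction_on (p := p) ?_ ?_ ?_ ?_
    · refine ⟨∅, Subset.rfl, isClopen_empty, fun F hF _ _ _ t' ht' => ?_⟩
      obtain rfl := subset_empty_iff.1 hF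
      have : t' = 1 := FaithfulSMul.eq_of_smul_eq_smul (α := X) fun y => by
        rw [ht'.map_of_ne y (by simp) (by simp) (by simp), one_smul]
      rw [this]; exact one_mem _
    · exact fun S T hST ⟨E, hE, hE'⟩ => ⟨E, hST.trans hE, hE'⟩
    · rintro S T ⟨E, hSE, hE, hE'⟩ ⟨E₂, hTE, hE₂, hE₂'⟩
      refine ⟨E ∪ E₂, union_subset_union hSE hTE, hE.union hE₂, fun F hF hFc hFo hFD t' ht' => ?_⟩
      have c₁ : IsCompact (F ∩ E) := hFc.inter_right hE.1
      have c₂ : IsCompact (F \ (F ∩ E)) := by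
        rw [sdiff_self_inter]; exact hFc.diff hE.2
      have o₂ : IsOpen (F \ (F ∩ E)) := hFo.sdiff c₁.isClosed
      obtain ⟨t₁, ht₁⟩ := ht'.restrict inter_subset_left c₁ (hFo.inter hE.2)
      obtain ⟨t₂, ht₂⟩ := ht'.restrict sdiff_subset c₂ o₂
      rw [ht'.eq_mul inter_subset_left ht₁ ht₂]
      refine mul_mem (hE' _ inter_subset_right c₁ (hFo.inter hE.2) (inter_subset_left.trans hFD)
        _ ht₁) (hE₂' _ ?_ c₂ o₂ (sdiff_subset.trans hFD) _ ht₂)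
      rintro x ⟨hx, hx'⟩
      exact (hF hx).resolve_left fun h => hx' ⟨hx, h⟩
    · intro x hx
      obtain ⟨S, hS, hS'⟩ := eventually_smallSets.1 (hN x hx)
      obtain ⟨E, hE, hxE, hES⟩ := loc_compact_Haus_tot_disc_of_zero_dim.mem_nhds_iff.1 hS
      exact ⟨E, mem_nhdsWithin_of_mem_nhds (hE.2.mem_nhds hxE), E, Subset.rfl, hE,
        fun F hF hFc hFo hFD => hS' F (hF.trans hES) hFc hFo hFD⟩
  obtain ⟨E, hDE, -, hE⟩ := hp
  exact hE D hDE h.isCompact h.isOpen Subset.rfl t h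

theorem eventually_exists_isCyc [IsFullAction G X] {x : X} {a b c : G} (hab : a • x ≠ b • x)
    (hbc : b • x ≠ c • x) (hca : c • x ≠ a • x) {U : Set X} (hU : IsOpen U) (ha : a • x ∈ U)
    (hb : b • x ∈ U) (hc : c • x ∈ U) :
    ∀ᶠ D in (𝓝 x).smallSets, IsCompact D → IsOpen D →
      ∃ t, IsCyc D a b c t ∧ ∀ y ∉ U, t • y = y := by
  filter_upwards [eventually_smul_ne hab, eventually_smul_ne hbc, eventually_smul_ne hca,
    eventually_smul_mem (hU.mem_nhds ha), eventually_smul_mem (hU.mem_nhds hb),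
    eventually_smul_mem (hU.mem_nhds hc)] with D h₁ h₂ h₃ h₄ h₅ h₆ hD hD'
  obtain ⟨t, ht⟩ := exists_isCyc hD hD' h₁ h₂ h₃
  exact ⟨t, ht, fun y hy => ht.map_of_ne y (fun x hx e => hy (e ▸ h₄ x hx))
    (fun x hx e => hy (e ▸ h₅ x hx)) (fun x hx e => hy (e ▸ h₆ x hx))⟩

end Existence

/-! ### Transitivity, perfectness and finite index subgroups -/

section Full

variable {G X : Type*} [Group G] [TopologicalSpace X] [MulAction G X]
  [T2Space X] [LocallyCompactSpace X] [TotallyDisconnectedSpace X] [PerfectSpace X]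
  [ContinuousConstSMul G X] [FaithfulSMul G X] [IsFullAction G X] [MulAction.IsMinimal G X]

omit [FaithfulSMul G X] in
theorem exists_mem_alt_smul_eq {U : Set X} (hU : IsOpen U) {p : X} {g : G} (hp : p ∈ U)
    (hq : g • p ∈ U) : ∃ a ∈ alt G U, a • p = g • p := by
  by_cases hpq : g • p = p
  · exact ⟨1, one_mem _, by rw [hpq, one_smul]⟩
  obtain ⟨h, hh, hh'⟩ := exists_smul_mem_notMem G hU ⟨p, hp⟩ (toFinite {p, g • p}) p
  simp only [mem_insert_iff, mem_singleton_iff, not_or] at hh'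
  obtain ⟨D, hD, hD', hpD, ht⟩ := exists_isCompact_isOpen (eventually_exists_isCyc (a := (1 : G))
    (b := g) (c := h) (x := p) (by simpa using Ne.symm hpq) (Ne.symm hh'.2) (by simpa using hh'.1)
    hU (by simpa using hp) hq hh)
  obtain ⟨t, ht, ht'⟩ := ht hD hD'
  exact ⟨t, ht.mem_alt ht', by simpa using ht.map_a p hpD⟩

omit [FaithfulSMul G X] in
/-- The group of `V` can push the part of a finite set which lies in `V` into a given nonempty
open subset of `V`. -/
theorem exists_mem_alt_gather {V W : Set X} (hV : IsOpen V) (hW : IsOpen W) (hWV : W ⊆ V)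
    (hne : W.Nonempty) (S : Finset X) : ∃ a ∈ alt G V, ∀ s ∈ S, s ∈ V → a • s ∈ W := by
  classical
  induction S using Finset.induction_on with
  | empty => exact ⟨1, one_mem _, by simp⟩
  | insert s S hs ih =>
    obtain ⟨a, ha, ha'⟩ := ih
    by_cases hsV : s ∈ V
    · have hfin : ((a • ·) '' (S : Set X)).Finite := S.finite_toSet.image _
      obtain ⟨g, hg, hg'⟩ := exists_smul_mem_notMem G hW hne hfin (a • s)
      obtain ⟨b, hb, hb'⟩ := exists_mem_alt_smul_eq (G := G) (hV.sdiff hfin.isClosed)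
        (p := a • s) (g := g) ⟨(smul_mem_iff_of_mem_alt ha).2 hsV, by simpa using hs⟩ ⟨hWV hg, hg'⟩
      refine ⟨b * a, mul_mem (alt_mono sdiff_subset hb) ha, fun x hx hxV => ?_⟩
      rw [mul_smul]
      rcases Finset.mem_insert.1 hx with rfl | hx
      · rw [hb']; exact hg
      · rw [smul_eq_of_mem_alt hb]
        · exact ha' x hx hxV
        · exact fun h => h.2 ⟨x, hx, rfl⟩
    · refine ⟨a, ha, fun x hx hxV => ?_⟩
      rcases Finset.mem_insert.1 hx with rfl | hx
      · exact absurd hxV hsV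
      · exact ha' x hx hxV

omit [PerfectSpace X] [IsMinimal G X] in
/-- If `N` contains the group of `U` and any three points of `W` can be moved into `U` by the
normalizer of `N`, then `N` contains the group of `W`. -/
theorem alt_le_of_normalizer {U W : Set X} (hU : IsOpen U) {N : Subgroup G} (hN : alt G U ≤ N)
    (h : ∀ x ∈ W, ∀ y ∈ W, ∀ z ∈ W, ∃ k ∈ Subgroup.normalizer (N : Set G),
      k • x ∈ U ∧ k • y ∈ U ∧ k • z ∈ U) :
    alt G W ≤ N := by
  rw [alt, Subgroup.closure_le]
  rintro t ⟨⟨D, a, b, c, ht⟩, ht'⟩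
  have hW : ∀ {a b c : G}, IsCyc D a b c t → ∀ x ∈ D, a • x ∈ W := fun h x hx => by
    by_contra hW
    exact h.moves hx (ht' _ hW)
  refine ht.mem_of_local fun x hx => ?_
  obtain ⟨k, hk, ha, hb, hc⟩ := h _ (hW ht x hx) _ (hW ht.rotate x hx) _ (hW ht.rotate.rotate x hx)
  rw [← mul_smul] at ha hb hc
  filter_upwards [eventually_smul_mem (hU.mem_nhds ha), eventually_smul_mem (hU.mem_nhds hb),
    eventually_smul_mem (hU.mem_nhds hc)] with E h₁ h₂ h₃ _ _ _ s hs
  rw [Subgroup.mem_normalizer_iff.1 hk s]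
  exact hN <| (hs.conj k).mem_alt fun y hy => (hs.conj k).map_of_ne y
    (fun x hx e => hy (e ▸ h₁ x hx)) (fun x hx e => hy (e ▸ h₂ x hx))
    (fun x hx e => hy (e ▸ h₃ x hx))

/-- The group of an open set is perfect. -/
theorem alt_le_of_commutator_mem {U : Set X} (hU : IsOpen U) {N : Subgroup G}
    (hN : ∀ s ∈ alt G U, ∀ t ∈ alt G U, s * t * s⁻¹ * t⁻¹ ∈ N) : alt G U ≤ N := by
  rw [alt, Subgroup.closure_le]
  rintro t ⟨⟨D, a, b, c, ht⟩, ht'⟩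
  have hW : ∀ {a b c : G}, IsCyc D a b c t → ∀ x ∈ D, a • x ∈ U := fun h x hx => by
    by_contra hW
    exact h.moves hx (ht' _ hW)
  refine ht.mem_of_local fun x hx => ?_
  have ha := hW ht x hx
  have hb := hW ht.rotate x hx
  have hc := hW ht.rotate.rotate x hx
  obtain ⟨d, hd, hd'⟩ := exists_smul_mem_notMem G hU ⟨_, ha⟩ (toFinite {a • x, b • x, c • x}) x
  obtain ⟨e, he, he'⟩ := exists_smul_mem_notMem G hU ⟨_, ha⟩
    (toFinite {a • x, b • x, c • x, d • x}) x
  simp only [mem_insert_iff, mem_singleton_iff, not_or] at hd' he'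
  obtain ⟨da, db, dc⟩ := hd'
  obtain ⟨ea, eb, ec, ed⟩ := he'
  filter_upwards [eventually_exists_isCyc (ht.ne_ab x hx x hx) (Ne.symm db) da hU ha hb hd,
    eventually_exists_isCyc (ht.ne_ca x hx x hx).symm (Ne.symm ec) ea hU ha hc he,
    eventually_smul_ne (Ne.symm eb), eventually_smul_ne dc, eventually_smul_ne (Ne.symm ed)]
    with E h₁ h₂ h₃ h₄ h₅ hE hE' hED t₁ ht₁
  obtain ⟨s, hs, hs'⟩ := h₁ hE hE'
  obtain ⟨u, hu, hu'⟩ := h₂ hE hE'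
  have := hs.commutator hu ht₁.ne_bc h₃ h₄ h₅
  rw [FaithfulSMul.eq_of_smul_eq_smul (α := X) (ht₁.smul_eq this)]
  exact hN s (hs.mem_alt hs') u (hu.mem_alt hu')

omit [FaithfulSMul G X] in
theorem infinite_alt {V : Set X} (hV : IsOpen V) (hne : V.Nonempty) : Infinite (alt G V) := by
  obtain ⟨x, hx⟩ := hne
  refine not_finite_iff_infinite.1 fun hfin => ?_
  obtain ⟨g, hg, hg'⟩ := exists_smul_mem_notMem G hV ⟨x, hx⟩
    (finite_range fun a : alt G V => (a : G) • x) x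
  obtain ⟨a, ha, ha'⟩ := exists_mem_alt_smul_eq hV hx hg
  exact hg' ⟨⟨a, ha⟩, ha'⟩

/-- The group of an open set has no proper subgroup of finite index. -/
theorem alt_le_of_relIndex_ne_zero {V : Set X} (hV : IsOpen V) (hne : V.Nonempty)
    {M : Subgroup G} (hM : M.relIndex (alt G V) ≠ 0) : alt G V ≤ M := by
  have := infinite_alt (G := G) hV hne
  have : (M.subgroupOf (alt G V)).FiniteIndex := ⟨hM⟩
  set C := (M.subgroupOf (alt G V)).normalCore with hC
  have hCbot : C ≠ ⊥ := fun h => by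
    have h1 : C.index ≠ 0 := Subgroup.FiniteIndex.index_ne_zero
    rw [h, Subgroup.index_bot] at h1
    exact h1 Nat.card_eq_zero_of_infinite
  obtain ⟨n, hn, hn1⟩ := C.bot_or_exists_ne_one.resolve_left hCbot
  set N : Subgroup G := C.map (alt G V).subtype with hN
  have hNM : N ≤ M := by
    rintro _ ⟨m, hm, rfl⟩
    exact Subgroup.mem_subgroupOf.1 (Subgroup.normalCore_le _ hm)
  have conj_mem : ∀ a ∈ alt G V, ∀ m ∈ N, a * m * a⁻¹ ∈ N := by
    rintro a ha _ ⟨m, hm, rfl⟩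
    exact ⟨⟨a, ha⟩ * m * ⟨a, ha⟩⁻¹, (Subgroup.normalCore_normal _).conj_mem m hm ⟨a, ha⟩, rfl⟩
  have hnN : (n : G) ∈ N := ⟨n, hn, rfl⟩
  -- `n` displaces a nonempty open subset `E` of `V`.
  obtain ⟨y, hy⟩ := exists_smul_ne (X := X) (g := (n : G)) (by simpa using hn1)
  have hyV : y ∈ V := by
    by_contra h
    exact hy (smul_eq_of_mem_alt n.2 y h)
  obtain ⟨A, B, hA, hB, hyA, hyB, hAB⟩ := t2_separation hy
  set E : Set X := V ∩ (B ∩ ((n : G) • ·) ⁻¹' A) with hE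
  have hEo : IsOpen E := hV.inter (hB.inter (hA.preimage (continuous_const_smul _)))
  have hyE : y ∈ E := ⟨hyV, hyB, hyA⟩
  have hEN : alt G E ≤ N := by
    refine alt_le_of_commutator_mem hEo fun s hs t ht => ?_
    have hsV := alt_mono inter_subset_left hs
    have htV := alt_mono inter_subset_left ht
    have hr : (n : G) * s⁻¹ * (n : G)⁻¹ ∈ alt G A := conj_mem_alt (inv_mem hs) fun z hz => hz.2.2
    set r := (n : G) * s⁻¹ * (n : G)⁻¹ with hr_def
    have hsr : s * r ∈ N := by
      have := mul_mem (conj_mem s hsV _ hnN) (inv_mem hnN)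
      rwa [hr_def, show s * ((n : G) * s⁻¹ * (n : G)⁻¹) = s * n * s⁻¹ * (n : G)⁻¹ by group]
    have hrt : r * t = t * r := commute_of_fix (smul_eq_of_mem_alt hr) (smul_eq_of_mem_alt ht)
      (hAB.mono_right fun z hz => hz.2.1)
    have := mul_mem hsr (conj_mem t htV _ (inv_mem hsr))
    rwa [show s * r * (t * (s * r)⁻¹ * t⁻¹) = s * t * s⁻¹ * t⁻¹ by
      calc s * r * (t * (s * r)⁻¹ * t⁻¹) = s * (r * t) * r⁻¹ * s⁻¹ * t⁻¹ := by group
        _ = s * t * s⁻¹ * t⁻¹ := by rw [hrt]; group] at this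
  refine (alt_le_of_normalizer hEo hEN fun x hx y hy z hz => ?_).trans hNM
  classical
  obtain ⟨a, ha, ha'⟩ := exists_mem_alt_gather (G := G) hV hEo inter_subset_left ⟨_, hyE⟩ {x, y, z}
  refine ⟨a, Subgroup.mem_normalizer_iff.2 fun m => ⟨conj_mem a ha m, fun h => ?_⟩,
    ha' x (by simp) hx, ha' y (by simp) hy, ha' z (by simp) hz⟩
  simpa [mul_assoc] using conj_mem a⁻¹ (inv_mem ha) _ h

/-- Two overlapping open sets whose groups lie in `H` may be replaced by their union. -/
theorem alt_union_le {U V : Set X} (hU : IsOpen U) (hV : IsOpen V) (hne : (U ∩ V).Nonempty)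
    {H : Subgroup G} (hUH : alt G U ≤ H) (hVH : alt G V ≤ H) : alt G (U ∪ V) ≤ H := by
  refine alt_le_of_normalizer hU hUH fun x hx y hy z hz => ?_
  classical
  obtain ⟨a, ha, ha'⟩ := exists_mem_alt_gather (G := G) hV (hU.inter hV) inter_subset_right hne
    {x, y, z}
  have key : ∀ s ∈ ({x, y, z} : Finset X), s ∈ U ∪ V → a • s ∈ U := fun s hs hs' => by
    by_cases hsV : s ∈ V
    · exact (ha' s hs hsV).1
    · rw [smul_eq_of_mem_alt ha s hsV]
      exact hs'.resolve_right hsV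
  exact ⟨a, Subgroup.le_normalizer (hVH ha), key x (by simp) hx, key y (by simp) hy,
    key z (by simp) hz⟩

/-! ### Elements of a confined subgroup with prescribed local action -/

/-- For each `a` preserving the pairwise disjoint sets `D p` and supported in their union, let
some `a⁻¹ * p * a` with `p ∈ P` lie in `H`, where `p` moves `D p` away from all these sets. If
`a⁻¹ * p * a` and `b⁻¹ * p * b` lie in `H`, then so does an element which acts on `D p` like
`b⁻¹ * a`. Hence finitely many cosets of the subgroups of all elements acting on `D p` like such
an element of `H` cover the group, and B. H. Neumann's lemma applies. -/
theorem exists_forall_exists_smul_eq {H : Subgroup G} {P : Finset G} {D : G → Set X}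
    (hD : ∀ p ∈ P, IsOpen (D p)) (hne : ∀ p ∈ P, (D p).Nonempty)
    (hdis : ∀ p ∈ P, ∀ q ∈ P, p ≠ q → Disjoint (D p) (D q))
    (hmove : ∀ p ∈ P, ∀ q ∈ P, ∀ x ∈ D p, p • x ∉ D q)
    (hP : ∀ a ∈ alt G (univ : Set X), ∃ p ∈ P, a⁻¹ * p * a ∈ H) :
    ∃ p ∈ P, ∀ k ∈ alt G (D p), ∃ h ∈ H, (∀ x ∈ D p, h • x = k • x) ∧
      ∀ x, (∀ q ∈ P, x ∉ D q) → (∀ q ∈ P, p • x ∉ D q) → h • x = x := by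
  classical
  let K : Subgroup G :=
    { carrier := {a | a ∈ alt G (univ : Set X) ∧ (∀ p ∈ P, ∀ x, a • x ∈ D p ↔ x ∈ D p) ∧
        ∀ x, (∀ p ∈ P, x ∉ D p) → a • x = x}
      one_mem' := ⟨one_mem _, by simp, by simp⟩
      mul_mem' := by
        rintro a b ⟨ha, ha', ha''⟩ ⟨hb, hb', hb''⟩
        refine ⟨mul_mem ha hb, fun p hp x => ?_, fun x hx => ?_⟩
        · rw [mul_smul, ha' p hp, hb' p hp]
        · rw [mul_smul, hb'' x hx, ha'' x hx]
      inv_mem' := by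
        rintro a ⟨ha, ha', ha''⟩
        refine ⟨inv_mem ha, fun p hp x => ?_, fun x hx => ?_⟩
        · rw [← ha' p hp, smul_inv_smul]
        · rw [inv_smul_eq_iff, ha'' x hx] }
  let M : G → Subgroup G := fun p =>
    { carrier := {k | (∀ x, k • x ∈ D p ↔ x ∈ D p) ∧ ∃ h ∈ H, (∀ x ∈ D p, h • x = k • x) ∧
        ∀ x, (∀ q ∈ P, x ∉ D q) → (∀ q ∈ P, p • x ∉ D q) → h • x = x}
      one_mem' := ⟨by simp, 1, one_mem _, by simp, by simp⟩
      mul_mem' := by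
        rintro k l ⟨hk, h, hh, h₁, h₂⟩ ⟨hl, h', hh', h₁', h₂'⟩
        refine ⟨fun x => by rw [mul_smul, hk, hl], h * h', mul_mem hh hh', fun x hx => ?_,
          fun x hx hx' => ?_⟩
        · rw [mul_smul, mul_smul, h₁' x hx, h₁ _ ((hl x).2 hx)]
        · rw [mul_smul, h₂' x hx hx', h₂ x hx hx']
      inv_mem' := by
        rintro k ⟨hk, h, hh, h₁, h₂⟩
        refine ⟨fun x => by rw [← hk, smul_inv_smul], h⁻¹, inv_mem hh, fun x hx => ?_,
          fun x hx hx' => ?_⟩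
        · rw [inv_smul_eq_iff, h₁ _ (by rwa [← hk, smul_inv_smul]), smul_inv_smul]
        · rw [inv_smul_eq_iff, h₂ x hx hx'] }
  have hb : ∀ p : G, ∃ b : K, (∃ a : K, (a : G)⁻¹ * p * a ∈ H) → (b : G)⁻¹ * p * b ∈ H := by
    intro p
    by_cases h : ∃ a : K, (a : G)⁻¹ * p * a ∈ H
    · exact ⟨h.choose, fun _ => h.choose_spec⟩
    · exact ⟨1, fun h' => absurd h' h⟩
  choose b hb using hb
  have cover : ⋃ p ∈ P, b p • ((M p).subgroupOf K : Set K) = univ := by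
    refine eq_univ_of_forall fun a => ?_
    obtain ⟨p, hp, hpa⟩ := hP a a.2.1
    have hpb := hb p ⟨a, hpa⟩
    simp only [mem_iUnion]
    refine ⟨p, hp, mem_smul_set_iff_inv_smul_mem.2 ?_⟩
    obtain ⟨-, ha, ha'⟩ := a.2
    obtain ⟨-, hb, hb'⟩ := (b p).2
    change (b p : G)⁻¹ * a ∈ M p
    have hinv : ∀ {c : G}, (∀ x, (∀ p ∈ P, x ∉ D p) → c • x = x) →
        ∀ x, (∀ p ∈ P, x ∉ D p) → c⁻¹ • x = x := fun hc x hx => by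
      rw [inv_smul_eq_iff, hc x hx]
    refine ⟨fun x => by rw [← hb p hp, mul_smul, smul_inv_smul, ha p hp], _,
      mul_mem (inv_mem hpb) hpa, fun x hx => ?_, fun x hx hx' => ?_⟩
    · have hax := fun q hq => hmove p hp q hq ((a : G) • x) ((ha p hp x).2 hx)
      simp only [mul_smul, mul_inv_rev, inv_inv]
      rw [hinv ha' _ hax, hb' _ hax, inv_smul_smul]
    · simp only [mul_smul, mul_inv_rev, inv_inv]
      rw [ha' x hx, hinv ha' _ hx', hb' _ hx', inv_smul_smul, hinv hb' x hx]
  obtain ⟨p, hp, hfin⟩ := Subgroup.exists_finiteIndex_of_leftCoset_cover cover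
  refine ⟨p, hp, fun k hk => ?_⟩
  have hle : alt G (D p) ≤ K := fun a ha => by
    refine ⟨alt_mono (subset_univ _) ha, fun q hq x => ?_, fun x hx =>
      smul_eq_of_mem_alt ha x (hx p hp)⟩
    by_cases hqp : q = p
    · rw [hqp]; exact smul_mem_iff_of_mem_alt ha
    · by_cases hx : x ∈ D p
      · exact iff_of_false (disjoint_right.1 (hdis q hq p hp hqp)
          ((smul_mem_iff_of_mem_alt ha).2 hx)) (disjoint_right.1 (hdis q hq p hp hqp) hx)
      · rw [smul_eq_of_mem_alt ha x hx]
  exact (alt_le_of_relIndex_ne_zero (hD p hp) (hne p hp)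
    (fun h => hfin.index_ne_zero (Subgroup.relIndex_eq_zero_of_le_right hle h)) hk).2

omit [FaithfulSMul G X] in
/-- An element of the group of `univ` may be corrected so that it moves one more point to a
prescribed place. -/
theorem exists_mem_alt_extend {a : G} (ha : a ∈ alt G (univ : Set X)) {S : Set X} (hS : S.Finite)
    {x : X} (hx : x ∉ S) {g : G} (hg : ∀ s ∈ S, a • s ≠ g • x) :
    ∃ b ∈ alt G (univ : Set X), b • x = g • x ∧ ∀ s ∈ S, b • s = a • s := by
  have hfin : ((a • ·) '' S).Finite := hS.image _
  obtain ⟨b, hb, hb'⟩ := exists_mem_alt_smul_eq (G := G) hfin.isClosed.isOpen_compl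
    (p := a • x) (g := g * a⁻¹) (by simpa using hx) (by
      rintro ⟨s, hs, e⟩
      exact hg s hs (by simpa [mul_smul] using e))
  refine ⟨b * a, mul_mem (alt_mono (subset_univ _) hb) ha, ?_, fun s hs => ?_⟩
  · rw [mul_smul, hb', mul_smul, inv_smul_smul]
  · rw [mul_smul, smul_eq_of_mem_alt hb]
    exact fun h => h ⟨s, hs, rfl⟩

omit [FaithfulSMul G X] in
/-- Finitely many distinct points can be moved to any distinct points of their orbits. -/
theorem exists_mem_alt_forall_smul_eq (S : Finset X) (g : X → G)
    (hg : ∀ x ∈ S, ∀ y ∈ S, g x • x = g y • y → x = y) :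
    ∃ a ∈ alt G (univ : Set X), ∀ x ∈ S, a • x = g x • x := by
  classical
  induction S using Finset.induction_on with
  | empty => exact ⟨1, one_mem _, by simp⟩
  | insert x S hx ih =>
    obtain ⟨a, ha, ha'⟩ := ih fun y hy z hz =>
      hg y (Finset.mem_insert_of_mem hy) z (Finset.mem_insert_of_mem hz)
    obtain ⟨b, hb, hbx, hb'⟩ := exists_mem_alt_extend ha S.finite_toSet (x := x) (by simpa using hx)
      (g := g x) (fun s hs e => by
        rw [ha' s hs] at e
        exact hx (hg s (Finset.mem_insert_of_mem hs) x (Finset.mem_insert_self _ _) e ▸ hs))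
    refine ⟨b, hb, fun y hy => ?_⟩
    rcases Finset.mem_insert.1 hy with rfl | hy
    · exact hbx
    · rw [hb' y hy, ha' y hy]

omit [LocallyCompactSpace X] [IsFullAction G X] [IsMinimal G X] in
/-- Points in general position for finitely many nontrivial elements. -/
theorem exists_smul_ne_forall [Nonempty X] (P : Finset G) (hP : 1 ∉ P) :
    ∃ x : G → X, (∀ p ∈ P, ∀ q ∈ P, x p = x q → p = q) ∧ ∀ p ∈ P, ∀ q ∈ P, p • x p ≠ x q := by
  classical
  induction P using Finset.induction_on with
  | empty =>
    exact ⟨fun _ => Classical.arbitrary X, by simp, by simp⟩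
  | insert p P hp ih =>
    simp only [Finset.mem_insert, not_or] at hP
    obtain ⟨x, hx, hx'⟩ := ih hP.2
    have hS : (x '' P ∪ (fun y => p⁻¹ • y) '' (x '' P) ∪ (fun q => q • x q) '' P).Finite :=
      ((P.finite_toSet.image _).union ((P.finite_toSet.image _).image _)).union
        (P.finite_toSet.image _)
    obtain ⟨y, hy, hyS⟩ := ((infinite_of_isOpen (isOpen_smul_ne (X := X) p)
      (exists_smul_ne (Ne.symm hP.1))).sdiff hS).nonempty
    simp only [mem_union, mem_image, not_or, not_exists, not_and, Finset.mem_coe] at hyS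
    obtain ⟨⟨h₁, h₂⟩, h₃⟩ := hyS
    have hne : ∀ q ∈ P, q ≠ p := fun q hq e => hp (e ▸ hq)
    refine ⟨Function.update x p y, fun q hq r hr e => ?_, fun q hq r hr => ?_⟩
    · rcases Finset.mem_insert.1 hq with rfl | hq' <;> rcases Finset.mem_insert.1 hr with rfl | hr'
      · rfl
      · rw [Function.update_self, Function.update_of_ne (hne r hr')] at e
        exact absurd e.symm (h₁ r hr')
      · rw [Function.update_self, Function.update_of_ne (hne q hq')] at e
        exact absurd e (h₁ q hq')
      · rw [Function.update_of_ne (hne q hq'), Function.update_of_ne (hne r hr')] at e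
        exact hx q hq' r hr' e
    · rcases Finset.mem_insert.1 hq with rfl | hq' <;> rcases Finset.mem_insert.1 hr with rfl | hr'
      · rw [Function.update_self]; exact hy
      · rw [Function.update_self, Function.update_of_ne (hne r hr')]
        exact fun e => h₂ _ ⟨r, hr', rfl⟩ (by rw [← e, inv_smul_smul])
      · rw [Function.update_self, Function.update_of_ne (hne q hq')]
        exact h₃ q hq'
      · rw [Function.update_of_ne (hne q hq'), Function.update_of_ne (hne r hr')]
        exact hx' q hq' r hr'

/-- A subgroup confined by the group of `univ` contains the group of some nonempty open set.

Let the points `x p`, `p ∈ P`, be in general position, with small neighbourhoods `D p`. For each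
choice of positions of the points `x p` and `p⁻¹ • x q`, realized by some `a e`, there is some `p`
such that every element supported in `a e • D p` agrees there with an element of `H` whose support
is otherwise close to the remaining positions. Positions are taken from a grid in such a way that,
by the pigeonhole principle, two choices give the same `p` and the same position of `x p`, but
disjoint sets of remaining positions. The commutators of the elements of `H` obtained from
these two choices are supported near the position of `x p`. -/
theorem exists_alt_le {H : Subgroup G} {P : Finset G} (h1 : 1 ∉ P)
    (hP : ∀ a ∈ alt G (univ : Set X), ∃ p ∈ P, a⁻¹ * p * a ∈ H) :
    ∃ V : Set X, IsOpen V ∧ V.Nonempty ∧ alt G V ≤ H := by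
  classical
  obtain ⟨p₀, hp₀, -⟩ := hP 1 (one_mem _)
  obtain ⟨x₀, -⟩ := exists_smul_ne (X := X) (g := p₀) fun h => h1 (h ▸ hp₀)
  have : Nonempty X := ⟨x₀⟩
  have : Infinite X := infinite_univ_iff.1 (infinite_of_isOpen isOpen_univ ⟨x₀, trivial⟩)
  obtain ⟨x, hx, hx'⟩ := exists_smul_ne_forall (X := X) P h1
  obtain ⟨O, hOinf, hO, hOdis⟩ := exists_seq_infinite_isOpen_pairwise_disjoint X
  have O_inj : ∀ {y : X} {m n : ℕ}, y ∈ O m → y ∈ O n → m = n := fun {y m n} hm hn => by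
    by_contra h
    exact disjoint_left.1 (hOdis h) hm hn
  -- `F` consists of the points `x p` and `p⁻¹ • x q`, numbered by `ι`.
  set F : Finset X := P.image x ∪ (P ×ˢ P).image fun pq => pq.1⁻¹ • x pq.2 with hF
  have hxF : ∀ p ∈ P, x p ∈ F := fun p hp =>
    Finset.mem_union_left _ (Finset.mem_image_of_mem _ hp)
  have hxF' : ∀ p ∈ P, ∀ q ∈ P, p⁻¹ • x q ∈ F := fun p hp q hq =>
    Finset.mem_union_right _ (Finset.mem_image.2 ⟨(p, q), Finset.mem_product.2 ⟨hp, hq⟩, rfl⟩)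
  obtain ⟨ι, hι⟩ := (countable_iff_exists_injOn (s := (F : Set X))).1 F.countable_toSet
  -- `z f m` moves `f` into the open set with number `(ι f, m)`.
  have hz : ∀ f m, ∃ g : G, g • f ∈ O (Nat.pair (ι f) m) := fun f m =>
    (hO _).exists_smul_mem G f (hOinf _).nonempty
  choose z hz using hz
  have ha : ∀ e : ℕ × ℕ, ∃ a ∈ alt G (univ : Set X), ∀ f ∈ F,
      a • f = z f (e.1 + ι f * e.2) • f := fun e =>
    exists_mem_alt_forall_smul_eq F (fun f => z f (e.1 + ι f * e.2)) fun f hf f' hf' h => by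
      have := O_inj (hz f (e.1 + ι f * e.2)) (h ▸ hz f' (e.1 + ι f' * e.2))
      exact hι hf hf' (Nat.pair_eq_pair.1 this).1
  choose a ha haF using ha
  -- The length `L` of the grid `E` makes it larger than the set of pairs of a possible `p` and a
  -- possible position of `x p`, as these positions are less than `L + B * (P.card + 1)`.
  set B := F.sup ι with hB
  set L := P.card * (B * (P.card + 1) + 1) + 1 with hL
  set E := Finset.range L ×ˢ Finset.range (P.card + 1) with hE
  have hE0 : ((0, 0) : ℕ × ℕ) ∈ E := by simp [hE, hL]
  -- The neighbourhoods of the points of `F`.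
  let N : X → Set X := fun f => ⋂ e ∈ E, (a e • ·) ⁻¹' O (Nat.pair (ι f) (e.1 + ι f * e.2))
  have hNo : ∀ f, IsOpen (N f) := fun f =>
    isOpen_biInter_finset fun e _ => (hO _).preimage (continuous_const_smul _)
  have hNmem : ∀ f ∈ F, f ∈ N f := fun f hf => mem_iInter₂.2 fun e _ => by
    change a e • f ∈ O _
    rw [haF e f hf]
    exact hz _ _
  have hNeq : ∀ f ∈ F, ∀ f' ∈ F, ∀ e ∈ E, ∀ e' ∈ E, ∀ y ∈ N f, ∀ y' ∈ N f',
      a e • y = a e' • y' → f = f' ∧ e.1 + ι f * e.2 = e'.1 + ι f * e'.2 := by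
    intro f hf f' hf' e he e' he' y hy y' hy' h
    have h₁ := mem_iInter₂.1 hy e he
    have h₂ := mem_iInter₂.1 hy' e' he'
    rw [mem_preimage] at h₁ h₂
    have h₃ := Nat.pair_eq_pair.1 (O_inj h₁ (h ▸ h₂))
    obtain rfl := hι hf hf' h₃.1
    exact ⟨rfl, h₃.2⟩
  have hNdis : ∀ f ∈ F, ∀ f' ∈ F, ∀ y ∈ N f, y ∈ N f' → f = f' := fun f hf f' hf' y hy hy' =>
    (hNeq f hf f' hf' _ hE0 _ hE0 y hy y hy' rfl).1
  let D : G → Set X := fun p => N (x p) ∩ ⋂ q ∈ P, (q⁻¹ • ·) ⁻¹' N (q⁻¹ • x p)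
  have hDo : ∀ p ∈ P, IsOpen (D p) := fun p _ =>
    (hNo _).inter (isOpen_biInter_finset fun q _ => (hNo _).preimage (continuous_const_smul _))
  have hxD : ∀ p ∈ P, x p ∈ D p := fun p hp =>
    ⟨hNmem _ (hxF p hp), mem_iInter₂.2 fun q hq => hNmem _ (hxF' q hq p hp)⟩
  have hDinv : ∀ p ∈ P, ∀ q ∈ P, ∀ y, p • y ∈ D q → y ∈ N (p⁻¹ • x q) := fun p hp q _ y hy => by
    simpa using mem_iInter₂.1 hy.2 p hp
  have hne : ∀ p ∈ P, ∀ q ∈ P, p⁻¹ • x q ≠ x p := fun p hp q hq h =>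
    hx' p hp q hq (by rw [← h, smul_inv_smul])
  have key : ∀ e : ℕ × ℕ, ∃ p ∈ P, ∀ k ∈ alt G (D p), ∃ h : G, a e * h * (a e)⁻¹ ∈ H ∧
      (∀ y ∈ D p, h • y = k • y) ∧
      ∀ y, (∀ q ∈ P, y ∉ D q) → (∀ q ∈ P, p • y ∉ D q) → h • y = y := fun e =>
    exists_forall_exists_smul_eq (H := H.comap (MulAut.conj (a e)).toMonoidHom) hDo
      (fun p hp => ⟨_, hxD p hp⟩)
      (fun p hp q hq hpq => disjoint_left.2 fun y hy hy' => hpq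
        (hx p hp q hq (hNdis _ (hxF p hp) _ (hxF q hq) y hy.1 hy'.1)))
      (fun p hp q hq y hy hy' => hne p hp q hq
        (hNdis _ (hxF' p hp q hq) _ (hxF p hp) y (hDinv p hp q hq y hy') hy.1))
      fun b hb => by
        obtain ⟨p, hp, hpH⟩ := hP (b * (a e)⁻¹) (mul_mem hb (inv_mem (ha e)))
        exact ⟨p, hp, by simpa [mul_assoc] using hpH⟩
  choose ans hans hlift using key
  obtain ⟨e, he, e', he', hee', hsame⟩ := Finset.exists_ne_map_eq_of_card_lt_of_maps_to
    (s := E) (t := P ×ˢ Finset.range (L + B * (P.card + 1)))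
    (f := fun e => (ans e, e.1 + ι (x (ans e)) * e.2))
    (by
      simp only [hE, Finset.card_product, Finset.card_range, hL]
      ring_nf
      nlinarith)
    (fun e he => by
      simp only [hE, Finset.coe_product, mem_prod, Finset.mem_coe, Finset.mem_range] at he
      simp only [Finset.coe_product, mem_prod, Finset.mem_coe, Finset.mem_range]
      exact ⟨hans e, add_lt_add_of_lt_of_le he.1
        (Nat.mul_le_mul (Finset.le_sup (f := ι) (hxF _ (hans e))) he.2.le)⟩)
  obtain ⟨hp, hcode⟩ := Prod.ext_iff.1 hsame
  simp only at hp hcode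
  have hlift' := hlift e'
  rw [← hp] at hlift' hcode
  have hpP := hans e
  have hlift₀ := hlift e
  generalize ans e = p at *
  -- The two choices disagree at all the points of `F` other than `x p`.
  have hdiff : ∀ f ∈ F, f ≠ x p → e.1 + ι f * e.2 ≠ e'.1 + ι f * e'.2 := by
    intro f hf hfx h
    have hι' : (ι f : ℤ) - ι (x p) ≠ 0 := fun h => hfx
      (hι hf (hxF p hpP) (by exact_mod_cast sub_eq_zero.1 h))
    zify at h hcode
    have h2 : ((ι f : ℤ) - ι (x p)) * (e.2 - e'.2) = 0 := by linarith
    have h3 : (e.2 : ℤ) = e'.2 := sub_eq_zero.1 ((mul_eq_zero.1 h2).resolve_left hι')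
    rw [h3] at h
    exact hee' (Prod.ext (by exact_mod_cast add_right_cancel h) (by exact_mod_cast h3))
  let T : Set X := ⋃ f ∈ F \ {x p}, N f
  have hT : ∀ {y}, y ∈ T ↔ ∃ f ∈ F, f ≠ x p ∧ y ∈ N f := fun {y} => by
    simp [T, and_assoc]
  let V : Set X := {y | (a e)⁻¹ • y ∈ D p ∧ (a e')⁻¹ • y ∈ D p}
  have hV : ∀ c ∈ ({e, e'} : Set (ℕ × ℕ)), ∀ y ∈ V, (a c)⁻¹ • y ∈ D p := by
    rintro c (rfl | rfl) y hy
    exacts [hy.1, hy.2]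
  have hVo : IsOpen V := ((hDo p hpP).preimage (continuous_const_smul _)).inter
    ((hDo p hpP).preimage (continuous_const_smul _))
  have hVne : V.Nonempty := by
    have h₁ := haF e _ (hxF p hpP)
    have h₂ := haF e' _ (hxF p hpP)
    rw [← hcode] at h₂
    refine ⟨a e • x p, ?_, ?_⟩
    · rw [inv_smul_smul]; exact hxD p hpP
    · rw [h₁, ← h₂, inv_smul_smul]; exact hxD p hpP
  let S : ℕ × ℕ → Set X := fun c => {y | (a c)⁻¹ • y ∈ T}
  have hlift'' : ∀ c ∈ ({e, e'} : Set (ℕ × ℕ)), ∀ s ∈ alt G V, ∃ r : G, s * r ∈ H ∧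
      ∀ y ∉ S c, r • y = y := by
    intro c hc s hs
    have hs' : (a c)⁻¹ * s * (a c)⁻¹⁻¹ ∈ alt G (D p) := conj_mem_alt hs (hV c hc)
    obtain ⟨h, hh, h₁, h₂⟩ : ∃ h : G, a c * h * (a c)⁻¹ ∈ H ∧
        (∀ y ∈ D p, h • y = ((a c)⁻¹ * s * (a c)⁻¹⁻¹) • y) ∧
        ∀ y, (∀ q ∈ P, y ∉ D q) → (∀ q ∈ P, p • y ∉ D q) → h • y = y := by
      rcases hc with rfl | rfl
      exacts [hlift₀ _ hs', hlift' _ hs']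
    refine ⟨s⁻¹ * (a c * h * (a c)⁻¹), by simpa [mul_assoc] using hh, fun y hy => ?_⟩
    rw [mul_smul, inv_smul_eq_iff, mul_smul, mul_smul]
    have hyT : ∀ f ∈ F, f ≠ x p → (a c)⁻¹ • y ∉ N f := fun f hf hfx h => hy (hT.2 ⟨f, hf, hfx, h⟩)
    by_cases hyD : (a c)⁻¹ • y ∈ D p
    · rw [h₁ _ hyD]
      simp [mul_smul]
    · rw [h₂, smul_inv_smul, smul_eq_of_mem_alt hs y fun h => hyD (hV c hc y h)]
      · intro q hq hyq
        by_cases hqp : q = p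
        · exact hyD (hqp ▸ hyq)
        · exact hyT _ (hxF q hq) (fun h => hqp (hx q hq p hpP h)) hyq.1
      · exact fun q hq hyq => hyT _ (hxF' p hpP q hq) (hne p hpP q hq) (hDinv p hpP q hq _ hyq)
  have hdisVS : ∀ c ∈ ({e, e'} : Set (ℕ × ℕ)), Disjoint (S c) V := fun c hc =>
    disjoint_left.2 fun y hyS hyV => by
      obtain ⟨f, hf, hfx, hyf⟩ := hT.1 hyS
      exact hfx (hNdis f hf _ (hxF p hpP) _ hyf (hV c hc y hyV).1)
  have hdisS : Disjoint (S e) (S e') := disjoint_left.2 fun y hy hy' => by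
    obtain ⟨f, hf, hfx, hyf⟩ := hT.1 hy
    obtain ⟨f', hf', -, hyf'⟩ := hT.1 hy'
    exact hdiff f hf hfx (hNeq f hf f' hf' e he e' he' _ hyf _ hyf' (by simp)).2
  refine ⟨V, hVo, hVne, alt_le_of_commutator_mem hVo fun s hs t ht => ?_⟩
  obtain ⟨r, hr, hrS⟩ := hlift'' e (by simp) s hs
  obtain ⟨q, hq, hqS⟩ := hlift'' e' (by simp) t ht
  have hsV := smul_eq_of_mem_alt hs
  have htV := smul_eq_of_mem_alt ht
  rw [← commutator_mul_mul (commute_of_fix hrS htV (hdisVS e (by simp)))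
    (commute_of_fix hrS hqS hdisS)
    (commute_of_fix hqS hsV (hdisVS e' (by simp)))]
  exact mul_mem (mul_mem (mul_mem hr hq) (inv_mem hr)) (inv_mem hq)

/-! ### Elements with trivial germ at a point -/

omit [LocallyCompactSpace X] [TotallyDisconnectedSpace X] [PerfectSpace X] [IsMinimal G X] in
/-- Up to elements supported away from `p`, a 3-cycle moving `p` is a 3-cycle of small sets. -/
theorem IsCycIn.eventually_exists_isCyc {U : Set X} {t : G} (ht : IsCycIn U t) {p : X}
    (hp : t • p ≠ p) : t • t • p ≠ p ∧ ∀ᶠ E in (𝓝 p).smallSets, IsCompact E → IsOpen E → p ∈ E →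
      ∃ t', IsCyc E 1 t (t * t) t' ∧ (∀ y ∉ U, t' • y = y) ∧ t'⁻¹ * t ∈ alt G (U \ {p}) := by
  obtain ⟨⟨D, a, b, c, h⟩, htU⟩ := ht
  obtain ⟨a, b, c, h, x, hx, rfl⟩ := h.exists_rotate hp
  have hpD : a • x ∈ a • D := smul_mem_smul_set hx
  replace h := h.rebase
  refine ⟨by simpa [mul_smul] using h.ne_ca _ hpD _ hpD, ?_⟩
  filter_upwards [eventually_smallSets_subset.2 (h.isOpen.mem_nhds hpD)] with E hE hEc hEo hpE
  obtain ⟨t', ht'⟩ := h.restrict hE hEc hEo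
  obtain ⟨t'', ht''⟩ := h.restrict sdiff_subset (h.isCompact.diff hEo) (h.isOpen.sdiff hEc.isClosed)
  refine ⟨t', ht', fun y hy => h.map_of_not_moved hE ht' (htU y hy), ?_⟩
  rw [h.eq_mul hE ht' ht'', inv_mul_cancel_left]
  refine IsCycIn.mem_alt_diff ⟨⟨_, _, _, _, ht''⟩, fun y hy =>
    h.map_of_not_moved sdiff_subset ht'' (htU y hy)⟩ (ht''.map_of_ne _ ?_ ?_ ?_)
  · rintro y hy e
    exact hy.2 (by simpa [← e] using hpE)
  · exact fun y hy e => h.ne_ab _ hpD y hy.1 (by rw [e, one_smul])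
  · exact fun y hy e => h.ne_ca y hy.1 _ hpD (by rw [e, one_smul])

/-- Two 3-cycles which agree near a point `p` that they move differ by an element of the group of
the complement of `p`. -/
theorem IsCycIn.inv_mul_mem_alt {U : Set X} (hU : IsOpen U) {p : X} {t t' : G} (ht : IsCycIn U t)
    (ht' : IsCycIn U t') (hp : t • p ≠ p) (h : ∀ᶠ y in 𝓝 p, t • y = t' • y) :
    t⁻¹ * t' ∈ alt G (U \ {p}) := by
  have htp : t • p = t' • p := h.self_of_nhds
  have hpU : p ∈ U := by
    by_contra hpU
    exact hp (ht.2 p hpU)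
  have htpU : t • p ∈ U := (smul_mem_iff_of_fix ht.2).2 hpU
  obtain ⟨v, hv, hv'⟩ := exists_smul_mem_notMem G hU ⟨p, hpU⟩
    (toFinite {p, t • p, (t * t) • p, (t' * t') • p}) p
  simp only [mem_insert_iff, mem_singleton_iff, not_or] at hv'
  obtain ⟨v₁, v₂, v₃, v₄⟩ := hv'
  have h₁ := (ht.eventually_exists_isCyc hp).2
  have h₂ := (ht'.eventually_exists_isCyc (htp ▸ hp)).2
  have h₃ := _root_.eventually_exists_isCyc (x := p) (a := (1 : G)) (b := t) (c := v)
    (by rw [one_smul]; exact hp.symm) (Ne.symm v₂) (by rwa [one_smul]) hU (by rwa [one_smul])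
    htpU hv
  obtain ⟨E, hE, hE', hpE, f₁, f₂, f₃, f₄, f₅, f₆⟩ := exists_isCompact_isOpen
    (h₁.and <| h₂.and <| h₃.and <| (eventually_smul_ne (Ne.symm v₃)).and <|
      (eventually_smul_ne v₄).and <| eventually_smallSets_forall.2 h)
  obtain ⟨t₁, ht₁, ht₁U, e₁⟩ := f₁ hE hE' hpE
  obtain ⟨t₂, ht₂, ht₂U, e₂⟩ := f₂ hE hE' hpE
  obtain ⟨r, hr, hrU⟩ := f₃ hE hE'
  have e₃ := ht₁.inv_mul_mem_alt hr ht₁U hrU hpE f₄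
  have e₄ := hr.inv_mul_mem_alt (ht₂.congr (fun _ _ => rfl) f₆ fun _ _ => rfl) hrU ht₂U hpE f₅
  have := mul_mem (mul_mem (mul_mem (inv_mem e₁) e₃) e₄) e₂
  rwa [show (t₁⁻¹ * t)⁻¹ * (t₁⁻¹ * r) * (r⁻¹ * t₂) * (t₂⁻¹ * t') = t⁻¹ * t' by group] at this

/-- Up to elements of the group of the complement of `p`, the 3-cycles multiply like their germs,
provided that the three points through which `p` moves are distinct. -/
theorem IsCycIn.inv_mul_mul_mem_alt {U : Set X} (hU : IsOpen U) {p : X} {s t t' : G}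
    (hs : IsCycIn U s) (ht : IsCycIn U t) (ht' : IsCycIn U t') (h₁ : s • p ≠ p)
    (h₂ : t • s • p ≠ s • p) (h₃ : t • s • p ≠ p) (h : ∀ᶠ y in 𝓝 p, t • s • y = t' • y) :
    t'⁻¹ * (t * s) ∈ alt G (U \ {p}) := by
  have hpU : p ∈ U := by
    by_contra hpU
    exact h₁ (hs.2 p hpU)
  have hspU : s • p ∈ U := (smul_mem_iff_of_fix hs.2).2 hpU
  have htspU : (t * s) • p ∈ U := by rw [mul_smul]; exact (smul_mem_iff_of_fix ht.2).2 hspU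
  obtain ⟨v, hv, hv'⟩ := exists_smul_mem_notMem G hU ⟨p, hpU⟩
    (toFinite {p, s • p, (t * s) • p}) p
  simp only [mem_insert_iff, mem_singleton_iff, not_or] at hv'
  obtain ⟨v₁, v₂, v₃⟩ := hv'
  obtain ⟨E, hE, hE', hpE, f₁, f₂, f₃, f₄⟩ := exists_isCompact_isOpen
    ((_root_.eventually_exists_isCyc (x := p) (a := (1 : G)) (b := s) (c := v)
      (by rw [one_smul]; exact h₁.symm) (Ne.symm v₂) (by rwa [one_smul]) hU (by rwa [one_smul])
      hspU hv).and <|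
    (_root_.eventually_exists_isCyc (x := p) (a := s) (b := t * s) (c := v)
      (by rw [mul_smul]; exact h₂.symm) (Ne.symm v₃) v₂ hU hspU htspU hv).and <|
    (eventually_smul_ne (x := p) (a := (1 : G)) (b := t * s)
      (by rw [mul_smul, one_smul]; exact h₃.symm)).and <| eventually_smallSets_forall.2 h)
  obtain ⟨s₁, hs₁, hs₁U⟩ := f₁ hE hE'
  obtain ⟨t₁, ht₁, ht₁U⟩ := f₂ hE hE'
  have hts := hs₁.mul ht₁ f₃
  have es : ∀ y ∈ E, s₁ • y = s • y := fun y hy => by simpa using hs₁.map_a y hy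
  have et : ∀ y ∈ E, t₁ • s • y = t • s • y := fun y hy => by
    simpa [mul_smul] using ht₁.map_a y hy
  have e₁ : s₁⁻¹ * s ∈ alt G (U \ {p}) := IsCycIn.inv_mul_mem_alt hU ⟨⟨_, _, _, _, hs₁⟩, hs₁U⟩ hs
    (by rwa [es p hpE]) (eventually_of_mem (hE'.mem_nhds hpE) es)
  have e₂ : t₁⁻¹ * t ∈ alt G (U \ {s • p}) := by
    refine IsCycIn.inv_mul_mem_alt hU ⟨⟨_, _, _, _, ht₁⟩, ht₁U⟩ ht (by rwa [et p hpE])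
      (eventually_of_mem ((hE'.smul s).mem_nhds (smul_mem_smul_set hpE)) ?_)
    rintro _ ⟨y, hy, rfl⟩
    exact et y hy
  have e₃ : t'⁻¹ * (t₁ * s₁) ∈ alt G (U \ {p}) := by
    refine IsCycIn.inv_mul_mem_alt hU ht' ⟨⟨_, _, _, _, hts⟩, fun y hy => ?_⟩
      (by rwa [← h.self_of_nhds]) (eventually_of_mem (hE'.mem_nhds hpE) fun y hy => ?_)
    · rw [mul_smul, hs₁U y hy, ht₁U y hy]
    · rw [mul_smul, es y hy, et y hy, f₄ y hy]
  have e₄ : s₁⁻¹ * (t₁⁻¹ * t) * s₁⁻¹⁻¹ ∈ alt G (U \ {p}) := conj_mem_alt e₂ fun y hy =>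
    ⟨by rw [← smul_mem_iff_of_fix hs₁U, smul_inv_smul]; exact hy.1, fun e => hy.2 (by
      rw [mem_singleton_iff, inv_smul_eq_iff, es p hpE] at e
      exact e)⟩
  have := mul_mem (mul_mem e₃ e₄) e₁
  rwa [show t'⁻¹ * (t₁ * s₁) * (s₁⁻¹ * (t₁⁻¹ * t) * s₁⁻¹⁻¹) * (s₁⁻¹ * s) = t'⁻¹ * (t * s) by
    group] at this

omit [FaithfulSMul G X] in
theorem exists_isCycIn {U : Set X} (hU : IsOpen U) {p : X} {g : G} (hp : p ∈ U) (hg : g • p ∈ U)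
    (hgp : g • p ≠ p) : ∃ t : G, IsCycIn U t ∧ ∀ᶠ y in 𝓝 p, t • y = g • y := by
  obtain ⟨h, hh, hh'⟩ := exists_smul_mem_notMem G hU ⟨p, hp⟩ (toFinite {p, g • p}) p
  simp only [mem_insert_iff, mem_singleton_iff, not_or] at hh'
  obtain ⟨D, hD, hD', hpD, ht⟩ := exists_isCompact_isOpen (eventually_exists_isCyc (a := (1 : G))
    (b := g) (c := h) (x := p) (by simpa using Ne.symm hgp) (Ne.symm hh'.2) (by simpa using hh'.1)
    hU (by simpa using hp) hg hh)
  obtain ⟨t, ht, ht'⟩ := ht hD hD'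
  exact ⟨t, ⟨⟨_, _, _, _, ht⟩, ht'⟩, eventually_of_mem (hD'.mem_nhds hpD) fun y hy => by
    simpa using ht.map_a y hy⟩

/-- An element of the group of `U` which is trivial near a point `q` is a product of 3-cycles
supported in `U` and away from `q`.

A word in the 3-cycles moves `q` along a path. Joining each point of the path to a point `w` off
the path by a 3-cycle `t` which depends on the germ of the corresponding part of the word,
each letter only changes the product of `t` and this part by an element of the group of
`U \ {q}`. -/
theorem mem_alt_diff_of_eventually {U : Set X} (hU : IsOpen U) {q : X} {a : G} (ha : a ∈ alt G U)
    (h : ∀ᶠ y in 𝓝 q, a • y = y) : a ∈ alt G (U \ {q}) := by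
  by_cases hq : q ∉ U
  · rwa [sdiff_singleton_eq_self hq]
  rw [not_not] at hq
  have step : ∀ s : G, IsCycIn U s → ∀ a ∈ alt G U,
      (∃ Z : Set X, Z.Finite ∧ ∀ t₀ t : G, IsCycIn U t₀ → IsCycIn U t → t₀ • q ≠ q → t₀ • q ∉ Z →
        (∀ᶠ y in 𝓝 q, t • a • y = t₀ • y) → t₀⁻¹ * (t * a) ∈ alt G (U \ {q})) →
      ∃ Z : Set X, Z.Finite ∧ ∀ t₀ t : G, IsCycIn U t₀ → IsCycIn U t → t₀ • q ≠ q → t₀ • q ∉ Z →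
        (∀ᶠ y in 𝓝 q, t • (s * a) • y = t₀ • y) → t₀⁻¹ * (t * (s * a)) ∈ alt G (U \ {q}) := by
    rintro s hs a ha ⟨Z, hZ, ih⟩
    refine ⟨Z ∪ {a • q, s • a • q}, hZ.union (toFinite _), fun t₀ t ht₀ ht hq₀ hqZ hev => ?_⟩
    simp only [mem_union, mem_insert_iff, mem_singleton_iff, not_or] at hqZ
    obtain ⟨hqZ, hqa, hqs⟩ := hqZ
    have haq : a • q ∈ U := (smul_mem_iff_of_mem_alt ha).2 hq
    obtain ⟨t', ht', ht'ev⟩ := exists_isCycIn (G := G) hU (p := a • q) (g := t₀ * a⁻¹) haq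
      (by rw [mul_smul, inv_smul_smul]; exact (smul_mem_iff_of_fix ht₀.2).2 hq)
      (by rwa [mul_smul, inv_smul_smul])
    have e₁ : t₀⁻¹ * (t' * a) ∈ alt G (U \ {q}) := by
      refine ih t₀ t' ht₀ ht' hq₀ hqZ ?_
      filter_upwards [(continuous_const_smul a).continuousAt.eventually ht'ev] with y hy
      rw [hy, mul_smul, inv_smul_smul]
    have hev' : ∀ᶠ y in 𝓝 (a • q), t • s • y = t' • y := by
      have hcont : Tendsto (a⁻¹ • · : X → X) (𝓝 (a • q)) (𝓝 q) := by
        have := (continuous_const_smul a⁻¹).tendsto (a • q)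
        rwa [inv_smul_smul] at this
      filter_upwards [ht'ev, hcont.eventually hev] with y h₁ h₂
      rw [h₁, mul_smul, ← h₂, mul_smul, smul_inv_smul]
    have ht'q : t' • a • q = t₀ • q := by rw [ht'ev.self_of_nhds, mul_smul, inv_smul_smul]
    have htsq : t • s • a • q = t₀ • q := by rw [hev'.self_of_nhds, ht'q]
    have e₂ : t'⁻¹ * (t * s) ∈ alt G (U \ {a • q}) := by
      by_cases hsq : s • a • q = a • q
      · obtain ⟨D, b, c, d, hD⟩ := hs.1
        rw [← mul_assoc]
        refine mul_mem (IsCycIn.inv_mul_mem_alt hU ht' ht (by rwa [ht'q]) ?_)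
          (hs.mem_alt_diff hsq)
        filter_upwards [hev', hD.eventually_smul_eq hsq] with y h₁ h₂
        rw [← h₁, h₂]
      · exact hs.inv_mul_mul_mem_alt hU ht ht' hsq (by rwa [htsq]) (by rwa [htsq]) hev'
    have e₃ : a⁻¹ * (t'⁻¹ * (t * s)) * a⁻¹⁻¹ ∈ alt G (U \ {q}) := conj_mem_alt e₂ fun y hy =>
      ⟨by rw [← smul_mem_iff_of_mem_alt ha, smul_inv_smul]; exact hy.1, fun e => hy.2 (by
        rw [mem_singleton_iff, inv_smul_eq_iff] at e
        exact e)⟩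
    have := mul_mem e₁ e₃
    rwa [show t₀⁻¹ * (t' * a) * (a⁻¹ * (t'⁻¹ * (t * s)) * a⁻¹⁻¹) = t₀⁻¹ * (t * (s * a)) by
      group] at this
  have key : ∀ a ∈ alt G U,
      ∃ Z : Set X, Z.Finite ∧ ∀ t₀ t : G, IsCycIn U t₀ → IsCycIn U t → t₀ • q ≠ q → t₀ • q ∉ Z →
        (∀ᶠ y in 𝓝 q, t • a • y = t₀ • y) → t₀⁻¹ * (t * a) ∈ alt G (U \ {q}) := by
    intro a ha
    refine Subgroup.closure_induction_left (p := fun a _ => _) ?_ (fun s hs a ha ih =>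
      step s hs a ha ih) (fun s hs a ha ih => step s⁻¹ ?_ a ha ih) ha
    · refine ⟨∅, finite_empty, fun t₀ t ht₀ ht hq₀ _ hev => ?_⟩
      rw [mul_one]
      exact ht₀.inv_mul_mem_alt hU ht hq₀ (hev.mono fun y hy => by rw [← hy, one_smul])
    · obtain ⟨⟨D, b, c, d, hD⟩, hs'⟩ := hs
      exact ⟨⟨_, _, _, _, hD.inv⟩, fun y hy => by rw [inv_smul_eq_iff, hs' y hy]⟩
  obtain ⟨Z, hZ, hZ'⟩ := key a ha
  obtain ⟨g, hg, hgZ⟩ := exists_smul_mem_notMem G hU ⟨q, hq⟩ (hZ.union (finite_singleton q)) q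
  simp only [mem_union, mem_singleton_iff, not_or] at hgZ
  obtain ⟨t, ht, htg⟩ := exists_isCycIn hU hq hg hgZ.2
  have htq := htg.self_of_nhds
  simpa using hZ' t t ht ht (by rw [htq]; exact hgZ.2) (by rw [htq]; exact hgZ.1)
    (h.mono fun y hy => by rw [hy])

theorem mem_alt_compl_of_eventually (Q : Finset X) {a : G} (ha : a ∈ alt G (univ : Set X))
    (h : ∀ q ∈ Q, ∀ᶠ y in 𝓝 q, a • y = y) : a ∈ alt G ((Q : Set X)ᶜ) := by
  classical
  induction Q using Finset.induction_on with
  | empty => simpa using ha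
  | insert q Q hq ih =>
    have := mem_alt_diff_of_eventually Q.finite_toSet.isClosed.isOpen_compl
      (ih fun q hq => h q (Finset.mem_insert_of_mem hq)) (h q (Finset.mem_insert_self _ _))
    rwa [Finset.coe_insert, insert_eq, union_comm, compl_union, ← sdiff_eq]

/-! ### Classification for full actions -/

/-- Given distinct points `q p` outside a nonempty open set `U`, some conjugation makes all
elements `p ∈ P` simultaneously move some points of `U` into `U` and some out of `U`. -/
theorem exists_mem_alt_forall_not_preserve {U : Set X} (hU : IsOpen U) (hne : U.Nonempty)
    (P : Finset G) (h1 : 1 ∉ P) (q : G → X) (hq : ∀ p ∈ P, q p ∉ U)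
    (hinj : ∀ p ∈ P, ∀ p' ∈ P, q p = q p' → p = p') :
    ∃ a ∈ alt G (univ : Set X), ∀ p ∈ P, ∃ u ∈ U, ∃ u' ∈ U,
      (a⁻¹ * p * a) • u ∈ U ∧ (a⁻¹ * p * a) • u' ∉ U := by
  classical
  -- The property for the elements of `P` only depends on the restriction of `a` to a finite set.
  suffices h : ∃ a ∈ alt G (univ : Set X), ∃ S : Set X, S.Finite ∧ S ⊆ U ∪ q '' P ∧
      ∀ b : G, (∀ s ∈ S, b • s = a • s) → ∀ p ∈ P, ∃ u ∈ U, ∃ u' ∈ U,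
        (b⁻¹ * p * b) • u ∈ U ∧ (b⁻¹ * p * b) • u' ∉ U by
    obtain ⟨a, ha, S, -, -, h⟩ := h
    exact ⟨a, ha, h a fun _ _ => rfl⟩
  induction P using Finset.induction_on with
  | empty => exact ⟨1, one_mem _, ∅, finite_empty, by simp, by simp⟩
  | insert p P hp ih =>
    simp only [Finset.mem_insert, not_or] at h1
    obtain ⟨a, ha, S, hS, hSU, hgood⟩ := ih h1.2
      (fun p hp => hq p (Finset.mem_insert_of_mem hp))
      (fun p hp p' hp' => hinj p (Finset.mem_insert_of_mem hp) p' (Finset.mem_insert_of_mem hp'))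
    have hpne : {x : X | p • x ≠ x}.Nonempty := exists_smul_ne (Ne.symm h1.1)
    have fresh : ∀ {R : Set X}, R.Finite → ∀ x : X, ∃ g : G, p • g • x ≠ g • x ∧ g • x ∉ R ∧
        p • g • x ∉ R := by
      intro R hR x
      obtain ⟨g, hg, hgR⟩ := exists_smul_mem_notMem G (isOpen_smul_ne p) hpne
        (hR.union (hR.image (p⁻¹ • ·))) x
      simp only [mem_union, not_or] at hgR
      exact ⟨g, hg, hgR.1, fun h => hgR.2 ⟨_, h, by simp⟩⟩
    -- `a` is extended so that it moves `u₁, u₂, u₃ ∈ U` and `q p ∉ U` to `v`, `p • v`, `v'` and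
    -- `p • v'`; then `p`, conjugated by it, moves `u₁` to `u₂` and `u₃` to `q p`.
    have hqp : q p ∉ U := hq p (Finset.mem_insert_self _ _)
    have hR : ((a • ·) '' S).Finite := hS.image _
    obtain ⟨k, hk, hkR, hkR'⟩ := fresh hR (q p)
    set v := k • q p with hv
    obtain ⟨g, hg, hgR, hgR'⟩ := fresh (hR.union (toFinite {v, p • v})) (q p)
    set v' := g • q p with hv'
    simp only [mem_union, mem_insert_iff, mem_singleton_iff, not_or] at hgR hgR'
    obtain ⟨hgR, hv'v, hv'pv⟩ := hgR
    obtain ⟨hgR', hpv'v, hpv'pv⟩ := hgR'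
    have hRS : ∀ {w : X}, w ∉ (a • ·) '' S → ∀ s ∈ S, a • s ≠ w := fun hw s hs e => hw ⟨s, hs, e⟩
    obtain ⟨g₁, hu₁, hu₁S⟩ := exists_smul_mem_notMem G hU hne hS v
    set u₁ := g₁ • v with hu₁v
    obtain ⟨b₁, hb₁, hb₁u, hb₁S⟩ := exists_mem_alt_extend ha hS hu₁S (g := g₁⁻¹)
      (by rw [hu₁v, inv_smul_smul]; exact hRS hkR)
    rw [hu₁v, inv_smul_smul, ← hu₁v] at hb₁u
    obtain ⟨g₂, hu₂, hu₂S⟩ := exists_smul_mem_notMem G hU hne (hS.insert u₁) v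
    set u₂ := g₂ • v with hu₂v
    obtain ⟨b₂, hb₂, hb₂u, hb₂S⟩ := exists_mem_alt_extend hb₁ (hS.insert u₁) hu₂S (g := p * g₂⁻¹)
      (by
        rw [hu₂v, mul_smul, inv_smul_smul]
        refine forall_mem_insert.2 ⟨by rw [hb₁u]; exact hk.symm, fun s hs => ?_⟩
        rw [hb₁S s hs]; exact hRS hkR' s hs)
    rw [hu₂v, mul_smul, inv_smul_smul, ← hu₂v] at hb₂u
    rw [forall_mem_insert] at hb₂S
    obtain ⟨g₃, hu₃, hu₃S⟩ := exists_smul_mem_notMem G hU hne ((hS.insert u₁).insert u₂) v'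
    set u₃ := g₃ • v' with hu₃v
    obtain ⟨b₃, hb₃, hb₃u, hb₃S⟩ := exists_mem_alt_extend hb₂ ((hS.insert u₁).insert u₂) hu₃S
      (g := g₃⁻¹) (by
        rw [hu₃v, inv_smul_smul]
        refine forall_mem_insert.2 ⟨by rw [hb₂u]; exact Ne.symm hv'pv, forall_mem_insert.2
          ⟨by rw [hb₂S.1, hb₁u]; exact Ne.symm hv'v, fun s hs => ?_⟩⟩
        rw [hb₂S.2 s hs, hb₁S s hs]; exact hRS hgR s hs)
    rw [hu₃v, inv_smul_smul, ← hu₃v] at hb₃u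
    simp only [forall_mem_insert] at hb₃S
    have hqS : q p ∉ insert u₃ (insert u₂ (insert u₁ S)) := by
      simp only [mem_insert_iff, not_or]
      refine ⟨fun e => hqp (e ▸ hu₃), fun e => hqp (e ▸ hu₂), fun e => hqp (e ▸ hu₁), fun h => ?_⟩
      rcases hSU h with h | ⟨p', hp', e⟩
      · exact hqp h
      · exact hp (hinj p' (Finset.mem_insert_of_mem hp') p (Finset.mem_insert_self _ _) e ▸ hp')
    obtain ⟨b, hb, hbq, hbS⟩ := exists_mem_alt_extend hb₃ (((hS.insert u₁).insert u₂).insert u₃) hqS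
      (g := p * g) (by
        rw [mul_smul, ← hv']
        refine forall_mem_insert.2 ⟨by rw [hb₃u]; exact hg.symm, forall_mem_insert.2
          ⟨by rw [hb₃S.1, hb₂u]; exact Ne.symm hpv'pv, forall_mem_insert.2
          ⟨by rw [hb₃S.2.1, hb₂S.1, hb₁u]; exact Ne.symm hpv'v, fun s hs => ?_⟩⟩⟩
        rw [hb₃S.2.2 s hs, hb₂S.2 s hs, hb₁S s hs]; exact hRS hgR' s hs)
    rw [mul_smul, ← hv'] at hbq
    simp only [forall_mem_insert] at hbS
    obtain ⟨hbu₃, hbu₂, hbu₁, hbS⟩ := hbS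
    rw [hb₃u] at hbu₃
    rw [hb₃S.1, hb₂u] at hbu₂
    rw [hb₃S.2.1, hb₂S.1, hb₁u] at hbu₁
    refine ⟨b, hb, insert (q p) (insert u₃ (insert u₂ (insert u₁ S))),
      (((hS.insert u₁).insert u₂).insert u₃).insert _, ?_, fun c hc p' hp' => ?_⟩
    · refine insert_subset (Or.inr ⟨p, by simp, rfl⟩) (insert_subset (Or.inl hu₃) (insert_subset
        (Or.inl hu₂) (insert_subset (Or.inl hu₁) (hSU.trans (union_subset_union_right _
        (image_mono ?_))))))
      simp
    · simp only [forall_mem_insert, hbq, hbu₁, hbu₂, hbu₃] at hc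
      obtain ⟨cq, c₃, c₂, c₁, cS⟩ := hc
      rcases Finset.mem_insert.1 hp' with rfl | hp'
      · refine ⟨u₁, hu₁, u₃, hu₃, ?_, ?_⟩
        · rwa [mul_smul, mul_smul, c₁, ← c₂, inv_smul_smul]
        · rwa [mul_smul, mul_smul, c₃, ← cq, inv_smul_smul]
      · refine hgood c (fun s hs => ?_) p' hp'
        rw [cS s hs, hbS s hs, hb₃S.2.2 s hs, hb₂S.2 s hs, hb₁S s hs]

/-- If no element of `H` moves points of `U` both into and out of `U`, then a finite set
outside `U` has fewer points than a confining set. -/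
theorem card_lt_of_forall_preserve {H : Subgroup G} {P : Finset G} (h1 : 1 ∉ P)
    (hP : ∀ a ∈ alt G (univ : Set X), ∃ p ∈ P, a⁻¹ * p * a ∈ H) {U : Set X} (hU : IsOpen U)
    (hne : U.Nonempty) (hH : ∀ h ∈ H, ∀ u ∈ U, ∀ u' ∈ U, h • u ∈ U → h • u' ∈ U) {T : Finset X}
    (hT : ∀ x ∈ T, x ∉ U) : T.card < P.card := by
  classical
  by_contra! hle
  obtain ⟨f⟩ : Nonempty (P ↪ T) := Function.Embedding.nonempty_of_card_le (by simpa using hle)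
  have hf : ∀ p (hp : p ∈ P), (if h : p ∈ P then (f ⟨p, h⟩ : X) else hne.some) = f ⟨p, hp⟩ :=
    fun p hp => dif_pos hp
  obtain ⟨a, ha, ha'⟩ := exists_mem_alt_forall_not_preserve hU hne P h1
    (fun p => if h : p ∈ P then (f ⟨p, h⟩ : X) else hne.some)
    (fun p hp => by rw [hf p hp]; exact hT _ (f _).2)
    fun p hp p' hp' e => by
      rw [hf p hp, hf p' hp'] at e
      exact congrArg Subtype.val (f.injective (Subtype.ext e))
  obtain ⟨p, hp, hpH⟩ := hP a ha
  obtain ⟨u, hu, u', hu', h₁, h₂⟩ := ha' p hp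
  exact h₂ (hH _ hpH u hu u' hu' h₁)

/-- A subgroup confined by the group of `univ` preserves a finite set `Q` and contains the group of
its complement, which is the largest open set containing some `V` whose group lies in `H`. -/
theorem exists_alt_compl_le {H : Subgroup G} {P : Finset G} (h1 : 1 ∉ P)
    (hP : ∀ a ∈ alt G (univ : Set X), ∃ p ∈ P, a⁻¹ * p * a ∈ H) :
    ∃ Q : Finset X, alt G ((Q : Set X)ᶜ) ≤ H ∧ H ≤ stabilizer G (Q : Set X) := by
  obtain ⟨V, hV, hVne, hVH⟩ := exists_alt_le h1 hP
  -- The largest open set containing `V` whose group lies in `H`.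
  let ℱ : Set (Set X) := {W | IsOpen W ∧ V ⊆ W ∧ alt G W ≤ H}
  have hunion : ∀ {W W'}, W ∈ ℱ → IsOpen W' → alt G W' ≤ H → (W ∩ W').Nonempty → W ∪ W' ∈ ℱ :=
    fun hW hW' hWH hne => ⟨hW.1.union hW', hW.2.1.trans subset_union_left,
      alt_union_le hW.1 hW' hne hW.2.2 hWH⟩
  have hVℱ : V ∈ ℱ := ⟨hV, Subset.rfl, hVH⟩
  set U : Set X := ⋃₀ ℱ with hUdef
  have hU : IsOpen U := isOpen_sUnion fun W hW => hW.1
  have hVU : V ⊆ U := subset_sUnion_of_mem hVℱ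
  have hUne : U.Nonempty := hVne.mono hVU
  have hUH : alt G U ≤ H := by
    rw [alt, Subgroup.closure_le]
    rintro t ⟨⟨D, a, b, c, ht⟩, htU⟩
    have : Nonempty ℱ := ⟨⟨V, hVℱ⟩⟩
    have hK : IsCompact (a • D ∪ b • D ∪ c • D) :=
      ((ht.isCompact.smul a).union (ht.isCompact.smul b)).union (ht.isCompact.smul c)
    have mem : ∀ {a b c : G}, IsCyc D a b c t → a • D ⊆ U := by
      rintro a b c ht _ ⟨x, hx, rfl⟩
      by_contra h
      exact ht.moves hx (htU _ h)
    obtain ⟨⟨W, hW⟩, hKW⟩ := hK.elim_directed_cover (fun W : ℱ => (W : Set X)) (fun W => W.2.1)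
      (by
        rw [← sUnion_eq_iUnion]
        exact union_subset (union_subset (mem ht) (mem ht.rotate)) (mem ht.rotate.rotate))
      (fun W W' => ⟨⟨_, hunion W.2 W'.2.1 W'.2.2.2
        (hVne.mono (subset_inter W.2.2.1 W'.2.2.1))⟩, subset_union_left, subset_union_right⟩)
    refine hW.2.2 (ht.mem_alt fun y hy => ht.map_of_ne y ?_ ?_ ?_)
    · exact fun x hx e => hy (hKW (Or.inl (Or.inl ⟨x, hx, e⟩)))
    · exact fun x hx e => hy (hKW (Or.inl (Or.inr ⟨x, hx, e⟩)))
    · exact fun x hx e => hy (hKW (Or.inr ⟨x, hx, e⟩))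
  -- `U` is a block for the action of `H`.
  have hblock : ∀ h ∈ H, ∀ u ∈ U, ∀ u' ∈ U, h • u ∈ U → h • u' ∈ U := by
    intro h hh u hu u' hu' hhu
    have hhU : alt G (h • U) ≤ H := fun t ht => by
      have : h⁻¹ * t * h⁻¹⁻¹ ∈ alt G U := conj_mem_alt ht fun y hy => by
        rwa [mem_smul_set_iff_inv_smul_mem] at hy
      have := mul_mem (mul_mem hh (hUH this)) (inv_mem hh)
      rwa [show h * (h⁻¹ * t * h⁻¹⁻¹) * h⁻¹ = t by group] at this
    have hUℱ : U ∈ ℱ := ⟨hU, hVU, hUH⟩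
    exact subset_sUnion_of_mem (hunion hUℱ (hU.smul h) hhU ⟨_, hhu, smul_mem_smul_set hu⟩)
      (Or.inr (smul_mem_smul_set hu'))
  have hfin : Uᶜ.Finite := by
    by_contra hinf
    obtain ⟨T, hT, hcard⟩ := Set.Infinite.exists_subset_card_eq hinf P.card
    exact (card_lt_of_forall_preserve h1 hP hU hUne hblock (fun x hx => hT hx)).ne hcard
  have hmaps : ∀ h ∈ H, ∀ u ∈ U, h • u ∈ U := by
    intro h hh u hu
    obtain ⟨v, hv, hv'⟩ := ((infinite_of_isOpen hU hUne).sdiff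
      (hfin.image (h⁻¹ • ·))).nonempty
    refine hblock h hh v hv u hu ?_
    by_contra hv''
    exact hv' ⟨h • v, hv'', by simp⟩
  refine ⟨hfin.toFinset, by simpa using hUH, fun h hh => ?_⟩
  rw [mem_stabilizer_set, Finite.coe_toFinset]
  exact fun x => not_congr ⟨fun hx => by simpa using hmaps h⁻¹ (inv_mem hh) _ hx,
    hmaps h hh x⟩

theorem germStabilizer_le_alt_compl (Q : Finset X) :
    germStabilizer (alt G (univ : Set X)) (Q : Set X) ≤ alt G ((Q : Set X)ᶜ) := by
  rintro a ⟨ha, U, hU, hQU, hfix⟩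
  exact mem_alt_compl_of_eventually Q ha fun q hq => eventually_of_mem (hU.mem_nhds (hQU hq)) hfix

omit [FaithfulSMul G X] in
theorem subset_of_germStabilizer_le {H : Subgroup G} {Q Q' : Finset X}
    (h : germStabilizer (alt G (univ : Set X)) (Q : Set X) ≤ H)
    (h' : H ≤ stabilizer G (Q' : Set X)) : Q' ⊆ Q := by
  intro q hq
  by_contra hqQ
  have hQo : IsOpen ((Q : Set X)ᶜ) := Q.finite_toSet.isClosed.isOpen_compl
  obtain ⟨g, hg, hg'⟩ := exists_smul_mem_notMem G hQo ⟨q, hqQ⟩ Q'.finite_toSet q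
  obtain ⟨t, ht, htg⟩ := exists_isCycIn hQo hqQ hg fun e => hg' (by rw [e]; exact hq)
  have := (mem_stabilizer_set.1 (h' (h (ht.mem_germStabilizer disjoint_compl_left))) q).2 hq
  rw [htg.self_of_nhds] at this
  exact hg' this

omit [FaithfulSMul G X] in
/-- Any `Q.card + 1` disjointly supported 3-cycles form a confining set for a group containing the
germ stabilizer of `Q`. -/
theorem exists_confining_of_germStabilizer_le [Nonempty X] {H : Subgroup G} {Q : Finset X}
    (h : germStabilizer (alt G (univ : Set X)) (Q : Set X) ≤ H) :
    ∃ P : Finset G, 1 ∉ P ∧ ∀ a : G, ∃ p ∈ P, a⁻¹ * p * a ∈ H := by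
  classical
  have : Infinite X := infinite_univ_iff.1 (infinite_of_isOpen isOpen_univ univ_nonempty)
  obtain ⟨Z, hZ⟩ := Infinite.exists_subset_card_eq X (Q.card + 1)
  obtain ⟨U, hU, hdis⟩ := Z.finite_toSet.t2_separation
  have : ∀ z, ∃ t : G, IsCycIn (U z) t ∧ t ≠ 1 := fun z => by
    obtain ⟨g, hg, hg'⟩ := exists_smul_mem_notMem G (hU z).2 ⟨z, (hU z).1⟩ (finite_singleton z) z
    obtain ⟨t, ht, htg⟩ := exists_isCycIn (hU z).2 (hU z).1 hg hg'
    refine ⟨t, ht, fun e => hg' ?_⟩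
    rw [mem_singleton_iff, ← htg.self_of_nhds, e, one_smul]
  choose t ht ht1 using this
  refine ⟨Z.image t, by simpa using fun z _ => ht1 z, fun a => ?_⟩
  obtain ⟨z, hz, hza⟩ : ∃ z ∈ Z, ∀ q ∈ Q, a • q ∉ U z := by
    by_contra! hcon
    have : ∀ z, ∃ q, z ∈ Z → q ∈ Q ∧ a • q ∈ U z := fun z => by
      by_cases hz : z ∈ Z
      · obtain ⟨q, hq⟩ := hcon z hz; exact ⟨q, fun _ => hq⟩
      · exact ⟨z, fun h => absurd h hz⟩
    choose f hf using this
    obtain ⟨z, hz, z', hz', hne, e⟩ := Finset.exists_ne_map_eq_of_card_lt_of_maps_to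
      (s := Z) (t := Q) (by omega) (f := f) fun z hz => (hf z hz).1
    exact disjoint_left.1 (hdis hz hz' hne) (hf z hz).2 (e ▸ (hf z' hz').2)
  refine ⟨t z, Finset.mem_image_of_mem _ hz, h ?_⟩
  have hc : IsCycIn (a⁻¹ • U z) (a⁻¹ * t z * a) := by
    obtain ⟨⟨D, b, c, d, hD⟩, hfix⟩ := ht z
    have := hD.conj a⁻¹
    rw [inv_inv] at this
    refine ⟨⟨_, _, _, _, this⟩, fun y hy => ?_⟩
    rw [mul_smul, mul_smul, hfix, inv_smul_smul]
    rwa [mem_smul_set_iff_inv_smul_mem, inv_inv] at hy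
  refine hc.mem_germStabilizer (disjoint_right.2 fun q hq h => hza q hq ?_)
  rwa [mem_smul_set_iff_inv_smul_mem, inv_inv] at h

end Full

/-! ### Cantor spaces and the Chabauty topology -/

section Cantor

theorem neBot_nhdsNE_pi_bool (y : ℕ → Bool) : (𝓝[≠] y).NeBot := by
  rw [← mem_closure_iff_nhdsWithin_neBot]
  refine mem_closure_of_tendsto (f := fun n => Function.update y n (!y n)) (b := atTop)
    (tendsto_pi_nhds.2 fun i => ?_) (Eventually.of_forall fun n h => ?_)
  · refine tendsto_const_nhds.congr' ?_
    filter_upwards [eventually_gt_atTop i] with n hn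
    rw [Function.update_of_ne hn.ne]
  · have := congrFun h n
    simp at this

theorem exists_isOpenEmbedding_of_isCantorSpace {X : Type*} [TopologicalSpace X]
    (hX : IsCantorSpace X ∨ IsLocallyCompactCantorSpace X) :
    Nonempty X ∧ ∃ f : X → ℕ → Bool, IsOpenEmbedding f := by
  rcases hX with ⟨⟨e⟩⟩ | ⟨U, hU, hU', ⟨e⟩⟩
  · exact ⟨⟨e.symm fun _ => true⟩, e, e.isOpenEmbedding⟩
  · have hne : U.Nonempty := nonempty_iff_ne_empty.2 fun h => hU' (h ▸ isClosed_empty)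
    exact ⟨⟨e.symm ⟨_, hne.some_mem⟩⟩, _, hU.isOpenEmbedding_subtypeVal.comp e.isOpenEmbedding⟩

theorem perfectSpace_of_isOpenEmbedding {X : Type*} [TopologicalSpace X] {f : X → ℕ → Bool}
    (hf : IsOpenEmbedding f) : PerfectSpace X := by
  refine perfectSpace_iff_forall_not_isolated.2 fun x => ⟨fun h => ?_⟩
  have hx : IsOpen {x} := by
    have := mem_nhdsWithin_iff_eventually.1 (h ▸ mem_bot : (∅ : Set X) ∈ 𝓝[≠] x)
    rw [isOpen_singleton_iff_nhds_eq_pure]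
    refine le_antisymm ?_ (pure_le_nhds x)
    rw [le_pure_iff]
    filter_upwards [this] with y hy
    by_contra hne
    exact hy hne
  have := hf.isOpenMap _ hx
  rw [image_singleton] at this
  exact (neBot_nhdsNE_pi_bool (f x)).ne (isOpen_singleton_iff_punctured_nhds _ |>.1 this)

end Cantor

section Confined

variable {G : Type*} [Group G]

theorem mem_conjSubgroup_iff {a p : G} {H : Subgroup G} :
    p ∈ conjSubgroup a H ↔ a⁻¹ * p * a ∈ H := by
  constructor
  · rintro ⟨h, hh, rfl⟩
    simpa [mul_assoc] using hh
  · exact fun h => ⟨_, h, by simp [mul_assoc]⟩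

/-- A subgroup is confined by `A` if and only if it has a confining set relative to `A`. -/
theorem isConfinedBy_iff {A H : Subgroup G} :
    IsConfinedBy A H ↔ ∃ P : Finset G, IsConfiningSet A H P := by
  classical
  have hcl := closure_induced (t := (Pi.topologicalSpace : TopologicalSpace (G → Bool)))
    (f := fun (H : Subgroup G) (g : G) => decide (g ∈ H)) (a := ⊥)
    (s := {K | ∃ a ∈ A, K = conjSubgroup a H})
  unfold IsConfinedBy
  rw [chabautyTopology, hcl, mem_closure_iff]
  push Not
  constructor
  · rintro ⟨o, ho, hbot, hempty⟩
    obtain ⟨I, u, hu, huo⟩ := isOpen_pi_iff.1 ho _ hbot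
    refine ⟨I.erase 1, by simp, fun a ha => ?_⟩
    by_contra! hcon
    refine eq_empty_iff_forall_notMem.1 hempty _ ⟨huo fun g hg => ?_, _, ⟨a, ha, rfl⟩, rfl⟩
    have : decide (g ∈ conjSubgroup a H) = decide (g ∈ (⊥ : Subgroup G)) := by
      by_cases h1 : g = 1
      · simp [h1, one_mem]
      · simp [h1, hcon g (Finset.mem_erase.2 ⟨h1, hg⟩)]
    change decide _ ∈ _
    rw [this]
    exact (hu g hg).2
  · rintro ⟨P, h1, hP⟩
    refine ⟨⋂ p ∈ P, (fun w : G → Bool => w p) ⁻¹' {false},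
      isOpen_biInter_finset fun p _ => (isOpen_discrete _).preimage (continuous_apply p), ?_, ?_⟩
    · simp only [mem_iInter]
      intro p hp
      have : p ≠ 1 := fun h => h1 (h ▸ hp)
      simpa using this
    · refine eq_empty_iff_forall_notMem.2 ?_
      rintro _ ⟨hw, _, ⟨a, ha, rfl⟩, rfl⟩
      obtain ⟨p, hp, hpa⟩ := hP a ha
      simpa [hpa] using mem_iInter₂.1 hw p hp

end Confined

/-! ### The action of the full group of an étale groupoid -/

namespace EtaleGroupoid

variable {X Γ : Type*} [TopologicalSpace X] [TopologicalSpace Γ] {𝒢 : EtaleGroupoid X Γ}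

theorem continuous_source : Continuous 𝒢.source := 𝒢.isLocalHomeomorph_source.continuous

theorem continuous_range : Continuous 𝒢.range := 𝒢.isLocalHomeomorph_range.continuous

theorem IsBisection.mono {T S : Set Γ} (hT : 𝒢.IsBisection T) (hS : IsOpen S) (h : S ⊆ T) :
    𝒢.IsBisection S :=
  ⟨hS, hT.injOn_source.mono h, hT.injOn_range.mono h⟩

namespace FullGroup

theorem smul_source {g : 𝒢.FullGroup} {γ : Γ} (hγ : γ ∈ g.carrier) :
    g • 𝒢.source γ = 𝒢.range γ := by
  change 𝒢.range (g.germ _) = _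
  rw [g.germ_eq hγ rfl]

theorem smul_eq {g : 𝒢.FullGroup} {γ : Γ} (hγ : γ ∈ g.carrier) {x : X} (hx : 𝒢.source γ = x) :
    g • x = 𝒢.range γ := hx ▸ smul_source hγ

theorem mem_graph_carrier {g : 𝒢.FullGroup} {x y : X} :
    (x, y) ∈ 𝒢.graph g.carrier ↔ g • x = y := by
  constructor
  · rintro ⟨γ, hγ, h⟩
    obtain ⟨rfl, rfl⟩ := Prod.ext_iff.1 h
    exact smul_source hγ
  · rintro rfl
    exact ⟨g.germ x, g.germ_mem x, Prod.ext (g.source_germ x) rfl⟩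

instance : ContinuousConstSMul 𝒢.FullGroup X where
  continuous_const_smul g := continuous_range.comp g.continuous_germ

end FullGroup

open FullGroup

theorem IsEffective.faithfulSMul (h : 𝒢.IsEffective) : FaithfulSMul 𝒢.FullGroup X where
  eq_of_smul_eq_smul {g g'} hg := FullGroup.ext <| h _ _ g.isBisection g'.isBisection <| by
    ext ⟨x, y⟩
    rw [mem_graph_carrier, mem_graph_carrier, hg]

/-- A permutation of the unit space given locally by bisections is given by an element of the full
group; by effectiveness, these bisections agree wherever they overlap. -/
theorem IsEffective.exists_fullGroup (h : 𝒢.IsEffective) (φ : Equiv.Perm X)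
    (hφ : ∀ x, ∃ T, 𝒢.IsBisection T ∧ x ∈ 𝒢.source '' T ∧ ∀ γ ∈ T, 𝒢.range γ = φ (𝒢.source γ)) :
    ∃ g : 𝒢.FullGroup, ∀ x, g • x = φ x := by
  let C : Set Γ := {γ | ∃ T, 𝒢.IsBisection T ∧ γ ∈ T ∧ ∀ δ ∈ T, 𝒢.range δ = φ (𝒢.source δ)}
  have hrange : ∀ γ ∈ C, 𝒢.range γ = φ (𝒢.source γ) := fun γ ⟨T, _, hγ, hT⟩ => hT γ hγ
  have hinj : InjOn 𝒢.source C := by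
    rintro γ ⟨T, hT, hγ, hTφ⟩ γ' ⟨T', hT', hγ', hTφ'⟩ e
    have key : ∀ {T T' : Set Γ}, 𝒢.IsBisection T → 𝒢.IsBisection T' →
        𝒢.IsBisection (T ∩ 𝒢.source ⁻¹' (𝒢.source '' T')) := fun hT hT' =>
      hT.mono (hT.isOpen.inter ((𝒢.isLocalHomeomorph_source.isOpenMap _ hT'.isOpen).preimage
        continuous_source)) inter_subset_left
    have sub : ∀ {T T' : Set Γ}, (∀ δ ∈ T, 𝒢.range δ = φ (𝒢.source δ)) →
        (∀ δ ∈ T', 𝒢.range δ = φ (𝒢.source δ)) →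
        𝒢.graph (T ∩ 𝒢.source ⁻¹' (𝒢.source '' T')) ⊆
          𝒢.graph (T' ∩ 𝒢.source ⁻¹' (𝒢.source '' T)) := by
      rintro T T' hT hT' _ ⟨δ, ⟨hδ, δ', hδ', e⟩, rfl⟩
      exact ⟨δ', ⟨hδ', δ, hδ, e.symm⟩, Prod.ext e ((hT' δ' hδ').trans (e ▸ (hT δ hδ).symm))⟩
    have := h _ _ (key hT hT') (key hT' hT) (Subset.antisymm (sub hTφ hTφ') (sub hTφ' hTφ))
    have hγ'' : γ ∈ T ∩ 𝒢.source ⁻¹' (𝒢.source '' T') := ⟨hγ, γ', hγ', e.symm⟩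
    rw [this] at hγ''
    exact hT'.injOn_source hγ''.1 hγ' e
  have hC : 𝒢.IsBisection C := by
    refine ⟨isOpen_iff_forall_mem_open.2 ?_, hinj, fun γ hγ γ' hγ' e => hinj hγ hγ' ?_⟩
    · rintro γ ⟨T, hT, hγ, hTφ⟩
      exact ⟨T, fun δ hδ => ⟨T, hT, hδ, hTφ⟩, hT.isOpen, hγ⟩
    · rw [hrange γ hγ, hrange γ' hγ'] at e
      exact φ.injective e
  have hsource : ∀ x, ∃ γ ∈ C, 𝒢.source γ = x := fun x => by
    obtain ⟨T, hT, ⟨γ, hγ, rfl⟩, hTφ⟩ := hφ x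
    exact ⟨γ, ⟨T, hT, hγ, hTφ⟩, rfl⟩
  refine ⟨⟨C, hC, eq_univ_of_forall hsource, eq_univ_of_forall fun y => ?_⟩, fun x => ?_⟩
  · obtain ⟨γ, hγ, e⟩ := hsource (φ.symm y)
    exact ⟨γ, hγ, by rw [hrange γ hγ, e, φ.apply_symm_apply]⟩
  · obtain ⟨γ, hγ, e⟩ := hsource x
    rw [FullGroup.smul_eq (show γ ∈ FullGroup.carrier _ from hγ) e, hrange γ hγ, e]

theorem IsEffective.isFullAction (h : 𝒢.IsEffective) : IsFullAction 𝒢.FullGroup X where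
  exists_smul_eq φ hφ := h.exists_fullGroup φ fun x => by
    obtain ⟨g, hg⟩ := hφ x
    obtain ⟨U, hU, hUo, hxU⟩ := eventually_nhds_iff.1 hg
    refine ⟨g.carrier ∩ 𝒢.source ⁻¹' U, g.isBisection.mono
      (g.isBisection.isOpen.inter (hUo.preimage continuous_source)) inter_subset_left,
      ⟨g.germ x, ⟨g.germ_mem x, ?_⟩, g.source_germ x⟩, fun γ hγ => ?_⟩
    · rwa [mem_preimage, g.source_germ]
    · rw [hU _ hγ.2, smul_source hγ.1]

theorem exists_isBisection_mem (γ : Γ) : ∃ T, 𝒢.IsBisection T ∧ γ ∈ T := by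
  obtain ⟨e, he, hes⟩ := 𝒢.isLocalHomeomorph_source γ
  obtain ⟨e', he', hes'⟩ := 𝒢.isLocalHomeomorph_range γ
  refine ⟨e.source ∩ e'.source, ⟨e.open_source.inter e'.open_source, ?_, ?_⟩, he, he'⟩
  · rw [hes]; exact e.injOn.mono inter_subset_left
  · rw [hes']; exact e'.injOn.mono inter_subset_right

theorem isOpen_image_unit {U : Set X} (hU : IsOpen U) : IsOpen (𝒢.unit '' U) := by
  have : 𝒢.unit '' U = Set.range 𝒢.unit ∩ 𝒢.source ⁻¹' U := by
    ext γ
    constructor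
    · rintro ⟨x, hx, rfl⟩
      exact ⟨⟨x, rfl⟩, by rwa [mem_preimage, 𝒢.source_unit]⟩
    · rintro ⟨⟨x, rfl⟩, hx⟩
      rw [mem_preimage, 𝒢.source_unit] at hx
      exact ⟨x, hx, rfl⟩
  rw [this]
  exact isOpen_range_unit.inter (hU.preimage continuous_source)

theorem IsBisection.isCompact_iff {T : Set Γ} (hT : 𝒢.IsBisection T) :
    IsCompact T ↔ IsCompact (𝒢.source '' T) := by
  have h : IsOpenEmbedding fun γ : T => 𝒢.source γ :=
    (𝒢.isLocalHomeomorph_source.comp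
      hT.isOpen.isOpenEmbedding_subtypeVal.isLocalHomeomorph).isOpenEmbedding_of_injective
      fun γ δ e => Subtype.ext (hT.injOn_source γ.2 δ.2 e)
  rw [isCompact_iff_isCompact_univ, h.isInducing.isCompact_iff, image_univ, image_eq_range]

/-- Every arrow between different units lies in an involution in the full group, which exchanges
the source and the range of a small bisection. -/
theorem exists_fullGroup_smul_source [T2Space X] [LocallyCompactSpace X]
    [TotallyDisconnectedSpace X] (γ : Γ) : ∃ g : 𝒢.FullGroup, g • 𝒢.source γ = 𝒢.range γ := by
  by_cases hγ : 𝒢.source γ = 𝒢.range γ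
  · exact ⟨1, by rw [one_smul, hγ]⟩
  obtain ⟨A, B, hA, hB, hγA, hγB, hAB⟩ := t2_separation hγ
  obtain ⟨T₀, hT₀, hγT₀⟩ := 𝒢.exists_isBisection_mem γ
  set T₁ := T₀ ∩ (𝒢.source ⁻¹' A ∩ 𝒢.range ⁻¹' B) with hT₁def
  have hT₁o : IsOpen T₁ := hT₀.isOpen.inter
    ((hA.preimage continuous_source).inter (hB.preimage continuous_range))
  have hγT₁ : γ ∈ T₁ := ⟨hγT₀, hγA, hγB⟩
  obtain ⟨D, hD, hDo, hγD, hDT⟩ := exists_isCompact_isOpen (x := 𝒢.source γ)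
    (p := fun D => D ⊆ 𝒢.source '' T₁) (eventually_smallSets_subset.2
      ((𝒢.isLocalHomeomorph_source.isOpenMap _ hT₁o).mem_nhds ⟨γ, hγT₁, rfl⟩))
  set T : Set Γ := T₁ ∩ 𝒢.source ⁻¹' D with hTdef
  have hT : 𝒢.IsBisection T :=
    hT₀.mono (hT₁o.inter (hDo.preimage continuous_source))
      (inter_subset_left.trans inter_subset_left)
  have hTD : 𝒢.source '' T = D := by
    rw [hTdef, image_inter_preimage, inter_eq_right]
    exact hDT
  have hK : IsClosed (𝒢.range '' T) :=
    ((hT.isCompact_iff.2 (hTD ▸ hD)).image continuous_range).isClosed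
  have hdis : ∀ δ ∈ T, ∀ δ' ∈ T, 𝒢.source δ ≠ 𝒢.range δ' := fun δ hδ δ' hδ' e =>
    disjoint_left.1 hAB hδ.1.2.1 (e ▸ hδ'.1.2.2)
  let R : Set X := (𝒢.source '' T ∪ 𝒢.range '' T)ᶜ
  have hR : IsOpen R := ((hTD ▸ hD.isClosed).union hK).isOpen_compl
  have hRs : ∀ δ ∈ T, 𝒢.source δ ∉ R := fun δ hδ h => h (Or.inl ⟨δ, hδ, rfl⟩)
  have hRr : ∀ δ ∈ T, 𝒢.range δ ∉ R := fun δ hδ h => h (Or.inr ⟨δ, hδ, rfl⟩)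
  have hinv : ∀ {δ}, 𝒢.inv δ ∈ T → 𝒢.source δ = 𝒢.range (𝒢.inv δ) ∧
      𝒢.range δ = 𝒢.source (𝒢.inv δ) := fun {δ} _ => ⟨(𝒢.range_inv δ).symm, (𝒢.source_inv δ).symm⟩
  have inv_inj : ∀ {δ ε : Γ}, 𝒢.inv δ = 𝒢.inv ε → δ = ε := fun {δ ε} e => by
    rw [← EtaleGroupoid.inv_inv (𝒢 := 𝒢) δ, e, EtaleGroupoid.inv_inv]
  let g : 𝒢.FullGroup :=
    { carrier := T ∪ 𝒢.inv ⁻¹' T ∪ 𝒢.unit '' R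
      isBisection := by
        refine ⟨(hT.isOpen.union (hT.isOpen.preimage 𝒢.continuous_inv)).union
          (isOpen_image_unit hR), ?_, ?_⟩
        · rintro δ ((hδ | hδ) | ⟨x, hx, rfl⟩) ε ((hε | hε) | ⟨y, hy, rfl⟩) e
          · exact hT.injOn_source hδ hε e
          · exact absurd (e.trans (hinv hε).1) (hdis _ hδ _ hε)
          · rw [𝒢.source_unit] at e
            exact absurd (e ▸ hy) (hRs δ hδ)
          · exact absurd (e.symm.trans (hinv hδ).1) (hdis _ hε _ hδ)
          · rw [(hinv hδ).1, (hinv hε).1] at e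
            exact inv_inj (hT.injOn_range hδ hε e)
          · rw [(hinv hδ).1, 𝒢.source_unit] at e
            exact absurd (e ▸ hy) (hRr _ hδ)
          · rw [𝒢.source_unit] at e
            exact absurd (e ▸ hx) (hRs _ hε)
          · rw [(hinv hε).1, 𝒢.source_unit] at e
            exact absurd (e ▸ hx) (hRr _ hε)
          · rw [𝒢.source_unit, 𝒢.source_unit] at e
            rw [e]
        · rintro δ ((hδ | hδ) | ⟨x, hx, rfl⟩) ε ((hε | hε) | ⟨y, hy, rfl⟩) e
          · exact hT.injOn_range hδ hε e
          · exact absurd ((hinv hε).2.symm.trans e.symm) (hdis _ hε _ hδ)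
          · rw [𝒢.range_unit] at e
            exact absurd (e ▸ hy) (hRr δ hδ)
          · exact absurd ((hinv hδ).2.symm.trans e) (hdis _ hδ _ hε)
          · rw [(hinv hδ).2, (hinv hε).2] at e
            exact inv_inj (hT.injOn_source hδ hε e)
          · rw [(hinv hδ).2, 𝒢.range_unit] at e
            exact absurd (e ▸ hy) (hRs _ hδ)
          · rw [𝒢.range_unit] at e
            exact absurd (e ▸ hx) (hRr _ hε)
          · rw [(hinv hε).2, 𝒢.range_unit] at e
            exact absurd (e ▸ hx) (hRs _ hε)
          · rw [𝒢.range_unit, 𝒢.range_unit] at e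
            rw [e]
      source_image := eq_univ_of_forall fun x => by
        by_cases hx : x ∈ R
        · exact ⟨_, Or.inr ⟨x, hx, rfl⟩, 𝒢.source_unit x⟩
        rcases not_not.1 hx with ⟨δ, hδ, rfl⟩ | ⟨δ, hδ, rfl⟩
        · exact ⟨δ, Or.inl (Or.inl hδ), rfl⟩
        · exact ⟨𝒢.inv δ, Or.inl (Or.inr (by rwa [mem_preimage, EtaleGroupoid.inv_inv])),
            𝒢.source_inv δ⟩
      range_image := eq_univ_of_forall fun x => by
        by_cases hx : x ∈ R
        · exact ⟨_, Or.inr ⟨x, hx, rfl⟩, 𝒢.range_unit x⟩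
        rcases not_not.1 hx with ⟨δ, hδ, rfl⟩ | ⟨δ, hδ, rfl⟩
        · exact ⟨𝒢.inv δ, Or.inl (Or.inr (by rwa [mem_preimage, EtaleGroupoid.inv_inv])),
            𝒢.range_inv δ⟩
        · exact ⟨δ, Or.inl (Or.inl hδ), rfl⟩ }
  exact ⟨g, smul_source (g := g) (Or.inl (Or.inl ⟨hγT₁, hγD⟩))⟩

theorem IsMinimal.isMinimal [T2Space X] [LocallyCompactSpace X] [TotallyDisconnectedSpace X]
    (h : 𝒢.IsMinimal) : MulAction.IsMinimal 𝒢.FullGroup X where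
  dense_orbit x := (h x).mono <| by
    rintro _ ⟨γ, rfl, rfl⟩
    exact exists_fullGroup_smul_source γ

namespace Multisection

variable {d : ℕ} (F : 𝒢.Multisection d)

/-- The set of units permuted by the multisection with index `i`. -/
def base (i : Fin d) : Set X := 𝒢.unit ⁻¹' F.toFun i i

theorem unit_source_mem {i j : Fin d} {γ : Γ} (hγ : γ ∈ F.toFun i j) :
    𝒢.source γ ∈ F.base j := by
  rw [← F.setMul_eq i j j] at hγ
  obtain ⟨α, -, δ, hδ, e, rfl⟩ := hγ
  obtain ⟨x, rfl⟩ := F.diag_subset j hδ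
  rw [𝒢.source_comp, 𝒢.source_unit]
  exact hδ

theorem unit_range_mem {i j : Fin d} {γ : Γ} (hγ : γ ∈ F.toFun i j) :
    𝒢.range γ ∈ F.base i := by
  rw [← F.setMul_eq i i j] at hγ
  obtain ⟨δ, hδ, α, -, e, rfl⟩ := hγ
  obtain ⟨x, rfl⟩ := F.diag_subset i hδ
  rw [𝒢.range_comp, 𝒢.range_unit]
  exact hδ

theorem exists_mem_source {j : Fin d} (i : Fin d) {x : X} (hx : x ∈ F.base j) :
    ∃ γ ∈ F.toFun i j, 𝒢.source γ = x := by
  have hx' : 𝒢.unit x ∈ F.toFun j j := hx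
  rw [← F.setMul_eq j i j] at hx'
  obtain ⟨α, -, δ, hδ, e, h⟩ := hx'
  exact ⟨δ, hδ, by rw [← 𝒢.source_comp α δ e, h, 𝒢.source_unit]⟩

theorem exists_mem_range {i : Fin d} (j : Fin d) {x : X} (hx : x ∈ F.base i) :
    ∃ γ ∈ F.toFun i j, 𝒢.range γ = x := by
  have hx' : 𝒢.unit x ∈ F.toFun i i := hx
  rw [← F.setMul_eq i j i] at hx'
  obtain ⟨α, hα, δ, -, e, h⟩ := hx'
  exact ⟨α, hα, by rw [← 𝒢.range_comp α δ e, h, 𝒢.range_unit]⟩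

theorem eq_of_mem_base {i j : Fin d} {x : X} (hi : x ∈ F.base i) (hj : x ∈ F.base j) : i = j := by
  by_contra h
  exact disjoint_left.1 (F.disjoint_diag i j h) hi hj

theorem image_source (i : Fin d) : 𝒢.source '' F.toFun i i = F.base i := by
  ext x
  constructor
  · rintro ⟨γ, hγ, rfl⟩
    exact F.unit_source_mem hγ
  · exact fun hx => ⟨_, hx, 𝒢.source_unit x⟩

theorem isCompact_base (i : Fin d) : IsCompact (F.base i) :=
  F.image_source i ▸ (F.isCompact_diag i).image continuous_source

theorem isOpen_base (i : Fin d) : IsOpen (F.base i) :=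
  (F.isBisection i i).isOpen.preimage 𝒢.isEmbedding_unit.continuous

theorem mem_perm {σ : Equiv.Perm (Fin d)} {γ : Γ} :
    γ ∈ F.perm σ ↔ (∃ i, γ ∈ F.toFun (σ i) i) ∨ ∃ x, 𝒢.unit x = γ ∧ ∀ i, x ∉ F.base i := by
  refine or_congr mem_iUnion ⟨?_, ?_⟩
  · rintro ⟨⟨x, rfl⟩, h⟩
    exact ⟨x, rfl, fun i hi => h (mem_iUnion.2 ⟨i, hi⟩)⟩
  · rintro ⟨x, rfl, h⟩
    exact ⟨⟨x, rfl⟩, fun h' => (mem_iUnion.1 h').elim h⟩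

/-- The element `F(σ)` of the full group. -/
def toFullGroup [T2Space X] (σ : Equiv.Perm (Fin d)) : 𝒢.FullGroup where
  carrier := F.perm σ
  isBisection := by
    refine ⟨?_, ?_, ?_⟩
    · have : F.perm σ = (⋃ i, F.toFun (σ i) i) ∪ 𝒢.unit '' (⋃ i, F.base i)ᶜ := by
        ext γ
        simp [mem_perm, and_comm]
      rw [this]
      exact (isOpen_iUnion fun i => (F.isBisection _ _).isOpen).union
        (isOpen_image_unit (isCompact_iUnion F.isCompact_base).isClosed.isOpen_compl)
    · intro γ hγ δ hδ e
      rcases F.mem_perm.1 hγ with ⟨i, hγ⟩ | ⟨x, rfl, hx⟩ <;>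
        rcases F.mem_perm.1 hδ with ⟨j, hδ⟩ | ⟨y, rfl, hy⟩
      · obtain rfl := F.eq_of_mem_base (F.unit_source_mem hγ) (e ▸ F.unit_source_mem hδ)
        exact (F.isBisection _ _).injOn_source hγ hδ e
      · rw [𝒢.source_unit] at e
        exact absurd (e ▸ F.unit_source_mem hγ) (hy i)
      · rw [𝒢.source_unit] at e
        exact absurd (e ▸ F.unit_source_mem hδ) (hx j)
      · rw [𝒢.source_unit, 𝒢.source_unit] at e
        rw [e]
    · intro γ hγ δ hδ e
      rcases F.mem_perm.1 hγ with ⟨i, hγ⟩ | ⟨x, rfl, hx⟩ <;>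
        rcases F.mem_perm.1 hδ with ⟨j, hδ⟩ | ⟨y, rfl, hy⟩
      · obtain rfl := σ.injective
          (F.eq_of_mem_base (F.unit_range_mem hγ) (e ▸ F.unit_range_mem hδ))
        exact (F.isBisection _ _).injOn_range hγ hδ e
      · rw [𝒢.range_unit] at e
        exact absurd (e ▸ F.unit_range_mem hγ) (hy _)
      · rw [𝒢.range_unit] at e
        exact absurd (e ▸ F.unit_range_mem hδ) (hx _)
      · rw [𝒢.range_unit, 𝒢.range_unit] at e
        rw [e]
  source_image := eq_univ_of_forall fun x => by
    by_cases h : ∃ i, x ∈ F.base i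
    · obtain ⟨i, hi⟩ := h
      obtain ⟨γ, hγ, e⟩ := F.exists_mem_source (σ i) hi
      exact ⟨γ, F.mem_perm.2 (Or.inl ⟨i, hγ⟩), e⟩
    · push Not at h
      exact ⟨_, F.mem_perm.2 (Or.inr ⟨x, rfl, h⟩), 𝒢.source_unit x⟩
  range_image := eq_univ_of_forall fun x => by
    by_cases h : ∃ i, x ∈ F.base i
    · obtain ⟨i, hi⟩ := h
      obtain ⟨γ, hγ, e⟩ := F.exists_mem_range (σ.symm i) hi
      exact ⟨γ, F.mem_perm.2 (Or.inl ⟨σ.symm i, by rwa [σ.apply_symm_apply]⟩), e⟩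
    · push Not at h
      exact ⟨_, F.mem_perm.2 (Or.inr ⟨x, rfl, h⟩), 𝒢.range_unit x⟩

section

variable [T2Space X]

theorem toFullGroup_smul {σ : Equiv.Perm (Fin d)} {i : Fin d} {γ : Γ}
    (hγ : γ ∈ F.toFun (σ i) i) : F.toFullGroup σ • 𝒢.source γ = 𝒢.range γ :=
  smul_source (F.mem_perm.2 (Or.inl ⟨i, hγ⟩))

theorem toFullGroup_smul_mem (σ : Equiv.Perm (Fin d)) {i : Fin d} {x : X} (hx : x ∈ F.base i) :
    F.toFullGroup σ • x ∈ F.base (σ i) := by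
  obtain ⟨γ, hγ, rfl⟩ := F.exists_mem_source (σ i) hx
  rw [F.toFullGroup_smul hγ]
  exact F.unit_range_mem hγ

theorem toFullGroup_smul_of_apply_eq {σ : Equiv.Perm (Fin d)} {i : Fin d} (hi : σ i = i) {x : X}
    (hx : x ∈ F.base i) : F.toFullGroup σ • x = x := by
  obtain ⟨γ, hγ, rfl⟩ := F.exists_mem_source (σ i) hx
  rw [F.toFullGroup_smul hγ]
  rw [hi] at hγ
  obtain ⟨y, rfl⟩ := F.diag_subset i hγ
  rw [𝒢.range_unit, 𝒢.source_unit]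

theorem toFullGroup_smul_of_notMem (σ : Equiv.Perm (Fin d)) {x : X} (hx : ∀ i, x ∉ F.base i) :
    F.toFullGroup σ • x = x := by
  rw [smul_eq (g := F.toFullGroup σ) (F.mem_perm.2 (Or.inr ⟨x, rfl, hx⟩)) (𝒢.source_unit x),
    𝒢.range_unit]

theorem toFullGroup_mul [FaithfulSMul 𝒢.FullGroup X] (σ τ : Equiv.Perm (Fin d)) :
    F.toFullGroup (σ * τ) = F.toFullGroup σ * F.toFullGroup τ := by
  refine FaithfulSMul.eq_of_smul_eq_smul (α := X) fun x => ?_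
  rw [mul_smul]
  by_cases h : ∃ i, x ∈ F.base i
  · obtain ⟨i, hi⟩ := h
    obtain ⟨γ, hγ, rfl⟩ := F.exists_mem_source (τ i) hi
    obtain ⟨δ, hδ, e⟩ := F.exists_mem_source (σ (τ i)) (F.unit_range_mem hγ)
    rw [F.toFullGroup_smul hγ, ← e, F.toFullGroup_smul hδ]
    have : 𝒢.comp δ γ e ∈ F.toFun ((σ * τ) i) i := by
      rw [← F.setMul_eq _ (τ i) i]
      exact ⟨δ, hδ, γ, hγ, e, rfl⟩
    rw [← 𝒢.source_comp δ γ e, F.toFullGroup_smul this, 𝒢.range_comp]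
  · push Not at h
    rw [F.toFullGroup_smul_of_notMem τ h, F.toFullGroup_smul_of_notMem σ h,
      F.toFullGroup_smul_of_notMem _ h]

/-- The homomorphism `σ ↦ F(σ)`. -/
def toFullGroupHom [FaithfulSMul 𝒢.FullGroup X] : Equiv.Perm (Fin d) →* 𝒢.FullGroup :=
  MonoidHom.mk' F.toFullGroup F.toFullGroup_mul

theorem toFullGroup_mem_alt [FaithfulSMul 𝒢.FullGroup X] {σ : Equiv.Perm (Fin d)}
    (hσ : σ ∈ alternatingGroup (Fin d)) : F.toFullGroup σ ∈ alt 𝒢.FullGroup (univ : Set X) := by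
  suffices h : alternatingGroup (Fin d) ≤ (alt 𝒢.FullGroup (univ : Set X)).comap F.toFullGroupHom
    from h hσ
  rw [← Equiv.Perm.closure_three_cycles_eq_alternating, Subgroup.closure_le]
  intro τ hτ
  obtain ⟨i, hi⟩ : ∃ i, i ∈ τ.support := by
    rw [← Finset.nonempty_def, ← Finset.card_pos, hτ.card_support]
    norm_num
  have hnodup := hτ.nodup_iff_mem_support.2 hi
  simp only [List.nodup_cons, List.mem_cons, List.not_mem_nil, or_false, not_or] at hnodup
  obtain ⟨⟨h₁, h₂⟩, h₃, -⟩ := hnodup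
  have hsupp := hτ.support_eq_iff_mem_support.2 hi
  have h3 : τ (τ (τ i)) = i := by
    have : τ ^ 3 = 1 := hτ.orderOf ▸ pow_orderOf_eq_one τ
    simpa [pow_succ] using congrArg (· i) this
  set t := F.toFullGroup τ with ht
  have ht3 : t * (t * t) = F.toFullGroup (τ * (τ * τ)) := by
    rw [F.toFullGroup_mul, F.toFullGroup_mul]
  have m₁ : ∀ {x}, x ∈ F.base i → t • x ∈ F.base (τ i) := F.toFullGroup_smul_mem τ
  have m₂ : ∀ {x}, x ∈ F.base i → (t * t) • x ∈ F.base (τ (τ i)) := fun hx => by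
    rw [mul_smul]; exact F.toFullGroup_smul_mem τ (m₁ hx)
  have m₃ : ∀ {x}, x ∈ F.base i → t • (t * t) • x = x := fun hx => by
    rw [← mul_smul, ht3]
    exact F.toFullGroup_smul_of_apply_eq h3 hx
  have hsurj : ∀ (ρ : Equiv.Perm (Fin d)) {x}, x ∈ F.base (ρ i) →
      ∃ y ∈ F.base i, F.toFullGroup ρ • y = x := fun ρ x hx => by
    refine ⟨F.toFullGroup ρ⁻¹ • x, by simpa using F.toFullGroup_smul_mem ρ⁻¹ hx, ?_⟩
    rw [← mul_smul, ← F.toFullGroup_mul, mul_inv_cancel]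
    exact F.toFullGroup_smul_of_apply_eq rfl hx
  refine IsCyc.mem_alt (D := F.base i) (a := 1) (b := t) (c := t * t)
    ⟨F.isCompact_base i, F.isOpen_base i, ?_, ?_, ?_, ?_, ?_, ?_, ?_⟩ fun y hy => absurd trivial hy
  · exact fun x hx y hy e => h₁ (F.eq_of_mem_base (by simpa using hx) (e ▸ m₁ hy))
  · exact fun x hx y hy e => h₃ (F.eq_of_mem_base (m₁ hx) (e ▸ m₂ hy))
  · exact fun x hx y hy e => h₂ (F.eq_of_mem_base (by simpa using hy) (e ▸ m₂ hx))
  · intro x hx; rw [one_smul]; rfl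
  · intro x hx; rw [mul_smul]; rfl
  · intro x hx; rw [one_smul]; exact m₃ hx
  · intro y h₁ h₂ h₃
    by_cases h : ∃ j, y ∈ F.base j
    · obtain ⟨j, hj⟩ := h
      by_cases hjs : j ∈ τ.support
      · exfalso
        rw [hsupp] at hjs
        simp only [Finset.mem_insert, Finset.mem_singleton] at hjs
        rcases hjs with rfl | rfl | rfl
        · exact h₁ y hj (one_smul _ _)
        · obtain ⟨x, hx, e⟩ := hsurj τ hj
          exact h₂ x hx e
        · obtain ⟨x, hx, e⟩ := hsurj (τ * τ) hj
          exact h₃ x hx (by rwa [F.toFullGroup_mul] at e)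
      · exact F.toFullGroup_smul_of_apply_eq (Equiv.Perm.notMem_support.1 hjs) hj
    · push Not at h
      exact F.toFullGroup_smul_of_notMem τ h

end

end Multisection

/-! ### The alternating full group is generated by 3-cycles -/

theorem IsEffective.unit_mem_carrier (h : 𝒢.IsEffective) {g : 𝒢.FullGroup} {x : X}
    (hx : ∀ᶠ y in 𝓝 x, g • y = y) : 𝒢.unit x ∈ g.carrier := by
  obtain ⟨U, hU, hUo, hxU⟩ := eventually_nhds_iff.1 hx
  have h₁ : 𝒢.IsBisection (g.carrier ∩ 𝒢.source ⁻¹' U) :=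
    g.isBisection.mono (g.isBisection.isOpen.inter (hUo.preimage continuous_source))
      inter_subset_left
  have h₂ : 𝒢.IsBisection (𝒢.unit '' U) :=
    (1 : 𝒢.FullGroup).isBisection.mono (isOpen_image_unit hUo) (image_subset_range _ _)
  have := h _ _ h₂ h₁ <| by
    ext ⟨y, z⟩
    constructor
    · rintro ⟨_, ⟨w, hw, rfl⟩, e⟩
      simp only [𝒢.source_unit, 𝒢.range_unit] at e
      obtain ⟨rfl, rfl⟩ := Prod.ext_iff.1 e
      exact ⟨g.germ w, ⟨g.germ_mem w, by rwa [mem_preimage, g.source_germ]⟩,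
        Prod.ext (g.source_germ w) (hU w hw)⟩
    · rintro ⟨γ, ⟨hγ, hγU⟩, e⟩
      obtain ⟨rfl, rfl⟩ := Prod.ext_iff.1 e
      refine ⟨_, ⟨_, hγU, rfl⟩, ?_⟩
      simp only [𝒢.source_unit, 𝒢.range_unit]
      rw [← smul_source hγ, hU _ hγU]
  exact (this ▸ mem_image_of_mem _ hxU : 𝒢.unit x ∈ g.carrier ∩ 𝒢.source ⁻¹' U).1

/-- A 3-cycle `t` of sets is of the form `F(σ)`, for the multisection of degree 3 formed by the
restrictions of the powers of `t`. -/
theorem IsEffective.mem_alternatingFullGroup [T2Space X] (heff : 𝒢.IsEffective)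
    [FaithfulSMul 𝒢.FullGroup X] {D : Set X} {a b c t : 𝒢.FullGroup} (h : IsCyc D a b c t) : t ∈ 𝒢.alternatingFullGroup := by
  replace h := h.rebase
  generalize a • D = E at h
  have ht3 := h.mul_mul_eq_one
  let p : Fin 3 → 𝒢.FullGroup := ![1, t, t * t]
  have hdis : ∀ i j, i ≠ j → ∀ x ∈ E, ∀ y ∈ E, p i • x ≠ p j • y := by
    intro i j hij x hx y hy
    fin_cases i <;> fin_cases j
    · exact absurd rfl hij
    · exact h.ne_ab x hx y hy
    · exact (h.ne_ca y hy x hx).symm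
    · exact (h.ne_ab y hy x hx).symm
    · exact absurd rfl hij
    · exact h.ne_bc x hx y hy
    · exact h.ne_ca x hx y hy
    · exact (h.ne_bc y hy x hx).symm
    · exact absurd rfl hij
  have hstep : ∀ i, p (finRotate 3 i) * (p i)⁻¹ = t := by
    intro i
    fin_cases i
    · change t * 1⁻¹ = t
      group
    · change t * t * t⁻¹ = t
      group
    · change 1 * (t * t)⁻¹ = t
      rw [one_mul, inv_eq_iff_mul_eq_one, mul_assoc, ht3]
  let S : Fin 3 → Fin 3 → Set Γ := fun i j =>
    (p i * (p j)⁻¹).carrier ∩ 𝒢.source ⁻¹' ((fun x => (p j)⁻¹ • x) ⁻¹' E)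
  have hdiag : ∀ i, S i i = 𝒢.unit '' (p i • E) := by
    intro i
    simp only [S, mul_inv_cancel, carrier_one]
    ext γ
    constructor
    · rintro ⟨⟨x, rfl⟩, hx⟩
      rw [mem_preimage, 𝒢.source_unit] at hx
      exact ⟨x, mem_smul_set_iff_inv_smul_mem.2 hx, rfl⟩
    · rintro ⟨x, hx, rfl⟩
      refine ⟨⟨x, rfl⟩, ?_⟩
      rw [mem_preimage, 𝒢.source_unit]
      exact mem_smul_set_iff_inv_smul_mem.1 hx
  let F : 𝒢.Multisection 3 :=
    { toFun := S
      isBisection := fun i j => (p i * (p j)⁻¹).isBisection.mono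
        ((p i * (p j)⁻¹).isBisection.isOpen.inter
          ((h.isOpen.preimage (continuous_const_smul _)).preimage continuous_source))
        inter_subset_left
      diag_subset := fun i => hdiag i ▸ image_subset_range _ _
      isCompact_diag := fun i =>
        hdiag i ▸ (h.isCompact.smul (p i)).image 𝒢.isEmbedding_unit.continuous
      disjoint_diag := fun i j hij => by
        rw [hdiag, hdiag, disjoint_image_iff 𝒢.isEmbedding_unit.injective, disjoint_left]
        rintro _ ⟨x, hx, rfl⟩ ⟨y, hy, e⟩
        exact hdis j i hij.symm y hy x hx e
      setMul_eq := fun i j k => by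
        have e : p i * (p j)⁻¹ * (p j * (p k)⁻¹) = p i * (p k)⁻¹ := by group
        ext ε
        constructor
        · rintro ⟨γ, hγ, δ, hδ, e', rfl⟩
          refine ⟨?_, ?_⟩
          · rw [← e]
            exact ⟨γ, hγ.1, δ, hδ.1, e', rfl⟩
          · rw [mem_preimage, 𝒢.source_comp]
            exact hδ.2
        · rintro ⟨hε, hεE⟩
          rw [← e] at hε
          obtain ⟨γ, hγ, δ, hδ, e', rfl⟩ := hε
          rw [mem_preimage, 𝒢.source_comp] at hεE
          refine ⟨γ, ⟨hγ, ?_⟩, δ, ⟨hδ, hεE⟩, e', rfl⟩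
          rw [mem_preimage, e', ← smul_source hδ, mem_preimage, mul_smul, inv_smul_smul]
          exact hεE }
  have hfix : ∀ x, (∀ i, (p i)⁻¹ • x ∉ E) → 𝒢.unit x ∈ t.carrier := fun x hx => by
    refine heff.unit_mem_carrier (h.eventually_smul_eq (h.map_of_ne x ?_ ?_ ?_))
    · rintro y hy rfl; exact hx 0 (by simpa [p] using hy)
    · rintro y hy rfl; exact hx 1 (by simpa [p] using hy)
    · rintro y hy rfl; exact hx 2 (by
        change (t * t)⁻¹ • (t * t) • y ∈ E
        rwa [inv_smul_smul])
  refine Subgroup.subset_closure ⟨3, le_rfl, F, finRotate 3, ?_, ?_⟩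
  · rw [Equiv.Perm.mem_alternatingGroup, sign_finRotate]
    rfl
  · have hmem : ∀ i γ, γ ∈ F.toFun (finRotate 3 i) i ↔
        γ ∈ t.carrier ∧ (p i)⁻¹ • 𝒢.source γ ∈ E := by
      intro i γ
      change γ ∈ (p (finRotate 3 i) * (p i)⁻¹).carrier ∩ _ ↔ _
      rw [hstep]
      rfl
    have hbase : ∀ i x, x ∈ F.base i ↔ (p i)⁻¹ • x ∈ E := by
      intro i x
      change 𝒢.unit x ∈ S i i ↔ _
      rw [hdiag, 𝒢.isEmbedding_unit.injective.mem_set_image, mem_smul_set_iff_inv_smul_mem]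
    ext γ
    simp only [F.mem_perm, hmem, hbase]
    constructor
    · intro hγ
      by_cases hE : ∃ i, (p i)⁻¹ • 𝒢.source γ ∈ E
      · obtain ⟨i, hi⟩ := hE
        exact Or.inl ⟨i, hγ, hi⟩
      · push Not at hE
        exact Or.inr ⟨_, t.isBisection.injOn_source (hfix _ hE) hγ (𝒢.source_unit _), hE⟩
    · rintro (⟨i, hγ, -⟩ | ⟨x, rfl, hx⟩)
      · exact hγ
      · exact hfix x hx

/-- The alternating full group is generated by the 3-cycles of compact open sets. -/
theorem IsEffective.alternatingFullGroup_eq [T2Space X] (heff : 𝒢.IsEffective)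
    [FaithfulSMul 𝒢.FullGroup X] :
    𝒢.alternatingFullGroup = alt 𝒢.FullGroup (univ : Set X) := by
  refine le_antisymm ?_ ?_
  · rw [alternatingFullGroup, Subgroup.closure_le]
    rintro g ⟨d, -, F, σ, hσ, hg⟩
    rw [show g = F.toFullGroup σ from FullGroup.ext hg]
    exact F.toFullGroup_mem_alt hσ
  · rw [alt, Subgroup.closure_le]
    rintro t ⟨⟨D, a, b, c, ht⟩, -⟩
    exact heff.mem_alternatingFullGroup ht

end EtaleGroupoid

theorem mainTheorem2 {X Γ : Type*} [TopologicalSpace X] [TopologicalSpace Γ]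
    (hX : IsCantorSpace X ∨ IsLocallyCompactCantorSpace X)
    (𝒢 : EtaleGroupoid X Γ) (hmin : 𝒢.IsMinimal) (heff : 𝒢.IsEffective)
    (H : Subgroup 𝒢.FullGroup) :
    [IsConfined H,
      IsConfinedBy 𝒢.alternatingFullGroup H,
      ∃! Q : Finset X, germStabilizer 𝒢.alternatingFullGroup (Q : Set X) ≤ H ∧
        H ≤ MulAction.stabilizer 𝒢.FullGroup (Q : Set X)].TFAE ∧
    ∀ (P : Finset 𝒢.FullGroup) (Q : Finset X),
      (IsConfiningSet ⊤ H P ∨ IsConfiningSet 𝒢.alternatingFullGroup H P) →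
      germStabilizer 𝒢.alternatingFullGroup (Q : Set X) ≤ H →
      H ≤ MulAction.stabilizer 𝒢.FullGroup (Q : Set X) →
      Q.card + 1 ≤ P.card := by
  obtain ⟨hne, f, hf⟩ := exists_isOpenEmbedding_of_isCantorSpace hX
  have : T2Space X := hf.isEmbedding.t2Space
  have : LocallyCompactSpace X := hf.locallyCompactSpace
  have : TotallyDisconnectedSpace X :=
    ⟨hf.isEmbedding.isTotallyDisconnected (isTotallyDisconnected_of_totallyDisconnectedSpace _)⟩
  have : PerfectSpace X := perfectSpace_of_isOpenEmbedding hf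
  have : FaithfulSMul 𝒢.FullGroup X := heff.faithfulSMul
  have : IsFullAction 𝒢.FullGroup X := heff.isFullAction
  have : MulAction.IsMinimal 𝒢.FullGroup X := hmin.isMinimal
  rw [heff.alternatingFullGroup_eq, IsConfined, isConfinedBy_iff, isConfinedBy_iff]
  have mono : ∀ {P}, IsConfiningSet ⊤ H P →
      IsConfiningSet (alt 𝒢.FullGroup (univ : Set X)) H P := fun h =>
    ⟨h.1, fun a _ => h.2 a trivial⟩
  have conj : ∀ {P}, IsConfiningSet (alt 𝒢.FullGroup (univ : Set X)) H P →
      ∀ a ∈ alt 𝒢.FullGroup (univ : Set X), ∃ p ∈ P, a⁻¹ * p * a ∈ H := fun h a ha => by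
    obtain ⟨p, hp, hpa⟩ := h.2 a ha
    exact ⟨p, hp, mem_conjSubgroup_iff.1 hpa⟩
  refine ⟨?_, fun P Q hP _ hQ => ?_⟩
  · tfae_have 1 → 2 := fun ⟨P, hP⟩ => ⟨P, mono hP⟩
    tfae_have 2 → 3 := by
      rintro ⟨P, hP⟩
      obtain ⟨Q, hQ, hQ'⟩ := exists_alt_compl_le hP.1 (conj hP)
      have hQ'' := (germStabilizer_le_alt_compl Q).trans hQ
      exact ⟨Q, ⟨hQ'', hQ'⟩, fun Q' h => (subset_of_germStabilizer_le hQ'' h.2).antisymm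
        (subset_of_germStabilizer_le h.1 hQ')⟩
    tfae_have 3 → 1 := by
      rintro ⟨Q, ⟨hQ, -⟩, -⟩
      obtain ⟨P, h1, hP⟩ := exists_confining_of_germStabilizer_le hQ
      refine ⟨P, h1, fun a _ => ?_⟩
      obtain ⟨p, hp, hpa⟩ := hP a
      exact ⟨p, hp, mem_conjSubgroup_iff.2 hpa⟩
    tfae_finish
  · replace hP := hP.elim mono id
    refine card_lt_of_forall_preserve hP.1 (conj hP) Q.finite_toSet.isClosed.isOpen_compl
      (infinite_of_isOpen isOpen_univ univ_nonempty |>.sdiff Q.finite_toSet |>.nonempty.mono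
        fun x hx => hx.2)
      (fun h hh u _ u' hu' _ hu'' => hu' ((mem_stabilizer_set.1 (hQ hh) u').1 hu''))
      fun x hx hx' => hx' hx
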